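/- A *right exact category* is an additive category $\mathcal E$ with a class of kernel-cokernel pairs $A\to B\to C$, called *conflations* and closed under isomorphism (the first map of a conflation is called an *inflation*, the second a *deflation*), such that (R0) $1_0\colon 0\to 0$ is a deflation; (R1) compositions of deflations are deflations; (R2) the pullback of a deflation along any morphism exists and is a deflation. Axiom (R0*) says that $A\to 0$ is a deflation for every object $A$. A cochain complex $X^\bullet$ over $\mathcal E$ is *acyclic* if for each $n$ the differential $d^{n-1}\colon X^{n-1}\to X^n$ is the composition of a deflation that is a cokernel of $d^{n-2}$ and an inflation that is a kernel of $d^{n}$. Let $\mathbf K(\mathcal E)$ be the homotopy category of cochain complexes; the acyclic complexes form a triangulated subcategory $\mathbf{Ac}(\mathcal E)$ of it (not necessarily closed under isomorphisms), and $\mathbf D(\mathcal E)$ is the Verdier quotient $\mathbf K(\mathcal E)/\mathbf{Ac}(\mathcal E)$, with suspension $\Sigma$. Let $\mathbf D^b(\mathcal E)$ be the full triangulated subcategory of $\mathbf D(\mathcal E)$ on the objects that are isomorphic in $\mathbf D(\mathcal E)$ to a bounded complex. Let $i\colon\mathcal E\to\mathbf D(\mathcal E)$ be the functor sending an object to the corresponding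 stalk complex in degree $0$. An object $P$ is *projective* if $\operatorname{Hom}(P,-)$ maps conflations to short exact sequences of abelian groups, and $\mathcal E$ *has enough projectives* if for each object $M$ there is a deflation $P\to M$ with $P$ projective. Let $\mathbf K^{-,b}(\operatorname{Proj}\mathcal E)$ be the full subcategory of $\mathbf K(\mathcal E)$ of complexes $X^\bullet$ with all $X^n$ projective, with $X^n=0$ for $n\gg 0$, and which are isomorphic in $\mathbf D(\mathcal E)$ to a bounded complex. **Theorem.** Let $\mathcal E$ be a right exact category. 1. The functor $i\colon\mathcal E\to\mathbf D(\mathcal E)$ is fully faithful. 2. For all $X,Y\in\mathcal E$ and all $n>0$, $\operatorname{Hom}_{\mathbf D(\mathcal E)}(\Sigma^n iX, iY)=0$. If moreover $\mathcal E$ satisfies (R0*), then 3. for each conflation $X\xrightarrow{f}Y\xrightarrow{g}Z$ in $\mathcal E$ there is a distinguished triangle $iX\xrightarrow{i(f)}iY\xrightarrow{i(g)}iZ\to\Sigma iX$ in $\mathbf D(\mathcal E)$; more generally, for cochain complexes $X^\bullet\xrightarrow{f^\bullet}Y^\bullet\xrightarrow{g^\bullet}Z^\bullet$ over $\mathcal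 E$ which form a conflation in each degree there is a distinguished triangle $X^\bullet\xrightarrow{f^\bullet}Y^\bullet\xrightarrow{g^\bullet}Z^\bullet\to\Sigma X^\bullet$ in $\mathbf D(\mathcal E)$; 4. if $\mathcal E$ has enough projectives, then the natural functor $\mathbf K^{-,b}(\operatorname{Proj}\mathcal E)\to\mathbf D^b(\mathcal E)$ (the restriction of the quotient functor $\mathbf K(\mathcal E)\to\mathbf D(\mathcal E)$) is a triangle equivalence. -/

import Mathlib

set_option linter.unusedSectionVars false
set_option linter.style.longLine false

universe v u

open CategoryTheory CategoryTheory.Limits CategoryTheory.Pretriangulated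
open scoped ZeroObject

namespace OneSidedExact

noncomputable section

/-- A conflation category: an additive category (the additivity is in the type class arguments)
with a class of kernel-cokernel pairs, called conflations, that is closed under isomorphisms. -/
class ConflationCategory (E : Type u) [Category.{v} E] [Preadditive E] [HasZeroObject E]
    [HasBinaryBiproducts E] where
  /-- the class of conflations `A ⟶ B ⟶ C` -/
  conflation : ShortComplex E → Prop
  conflation_of_iso : ∀ {S T : ShortComplex E}, (S ≅ T) → conflation S → conflation T
  isKernel : ∀ {S : ShortComplex E}, conflation S →
    Nonempty (IsLimit (KernelFork.ofι S.f S.zero))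
  isCokernel : ∀ {S : ShortComplex E}, conflation S →
    Nonempty (IsColimit (CokernelCofork.ofπ S.g S.zero))

section Conflation

variable {E : Type u} [Category.{v} E] [Preadditive E] [HasZeroObject E]
  [HasBinaryBiproducts E] [ConflationCategory E]

open ConflationCategory

/-- Deflations are the second maps of conflations. -/
def IsDeflation {B C : E} (g : B ⟶ C) : Prop :=
  ∃ (A : E) (f : A ⟶ B) (w : f ≫ g = 0), conflation (ShortComplex.mk f g w)

/-- Inflations are the first maps of conflations. -/
def IsInflation {A B : E} (f : A ⟶ B) : Prop :=
  ∃ (C : E) (g : B ⟶ C) (w : f ≫ g = 0), conflation (ShortComplex.mk f g w)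

end Conflation

/-- Right exact (or deflation-exact) categories: conflation categories satisfying the axioms
R0, R1 and R2. -/
class RightExactCategory (E : Type u) [Category.{v} E] [Preadditive E] [HasZeroObject E]
    [HasBinaryBiproducts E] extends ConflationCategory E where
  isDeflation_id_zero : IsDeflation (𝟙 (0 : E))
  isDeflation_comp : ∀ {X Y Z : E} (f : X ⟶ Y) (g : Y ⟶ Z),
    IsDeflation f → IsDeflation g → IsDeflation (f ≫ g)
  exists_pullback : ∀ {Y Z W : E} (g : Y ⟶ W) (f : Z ⟶ W), IsDeflation g →
    ∃ (X : E) (a : X ⟶ Y) (b : X ⟶ Z), IsPullback a b g f ∧ IsDeflation b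

/-- Axiom R0*: for every object `A`, the map `A ⟶ 0` is a deflation. -/
def AxiomR0Star (E : Type u) [Category.{v} E] [Preadditive E] [HasZeroObject E]
    [HasBinaryBiproducts E] [ConflationCategory E] : Prop :=
  ∀ A : E, IsDeflation (0 : A ⟶ (0 : E))

section Basic

variable {E : Type u} [Category.{v} E] [Preadditive E] [HasZeroObject E]
  [HasBinaryBiproducts E]

open ConflationCategory RightExactCategory

lemma conflation_mono [ConflationCategory E] {S : ShortComplex E} (h : conflation S) :
    Mono S.f := by
  obtain ⟨hf⟩ := isKernel h
  exact Fork.IsLimit.mono hf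

lemma conflation_epi [ConflationCategory E] {S : ShortComplex E} (h : conflation S) :
    Epi S.g := by
  obtain ⟨hf⟩ := isCokernel h
  exact Cofork.IsColimit.epi hf

lemma conflation_lift [ConflationCategory E] {S : ShortComplex E} (h : conflation S)
    {T : E} (k : T ⟶ S.X₂) (hk : k ≫ S.g = 0) : ∃ l : T ⟶ S.X₁, l ≫ S.f = k := by
  obtain ⟨hf⟩ := isKernel h
  exact ⟨hf.lift (KernelFork.ofι k hk), hf.fac _ WalkingParallelPair.zero⟩

lemma conflation_desc [ConflationCategory E] {S : ShortComplex E} (h : conflation S)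
    {T : E} (k : S.X₂ ⟶ T) (hk : S.f ≫ k = 0) : ∃ l : S.X₃ ⟶ T, S.g ≫ l = k := by
  obtain ⟨hf⟩ := isCokernel h
  exact ⟨hf.desc (CokernelCofork.ofπ k hk), hf.fac _ WalkingParallelPair.one⟩

/-- If `g` is a deflation and `f` is a kernel of `g`, then `(f, g)` is a conflation. -/
lemma conflation_of_isDeflation [ConflationCategory E] (S : ShortComplex E)
    (hg : IsDeflation S.g) [Mono S.f]
    (hf : ∀ {T : E} (k : T ⟶ S.X₂), k ≫ S.g = 0 → ∃ l : T ⟶ S.X₁, l ≫ S.f = k) :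
    conflation S := by
  obtain ⟨A, f, w, h⟩ := hg
  have := conflation_mono h
  dsimp at this
  obtain ⟨a, ha⟩ := hf f w
  obtain ⟨b, hb⟩ := conflation_lift h S.f S.zero
  dsimp at b hb
  refine conflation_of_iso (ShortComplex.isoMk (S₁ := ShortComplex.mk f S.g w) (S₂ := S)
    ⟨a, b, ?_, ?_⟩ (Iso.refl _) (Iso.refl _) (by simpa using ha) (by simp)) h
  · rw [← cancel_mono f]; simp [hb, ha]
  · rw [← cancel_mono S.f]; simp [hb, ha]

lemma isDeflation_of_arrow_iso [ConflationCategory E] {A B A' B' : E} {f : A ⟶ B} {g : A' ⟶ B'}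
    (a : A ≅ A') (b : B ≅ B') (w : f ≫ b.hom = a.hom ≫ g) (hf : IsDeflation f) :
    IsDeflation g := by
  obtain ⟨K, k, hk, h⟩ := hf
  refine ⟨K, k ≫ a.hom, by rw [Category.assoc, ← w, reassoc_of% hk, zero_comp],
    conflation_of_iso (ShortComplex.isoMk (S₁ := ShortComplex.mk k f hk)
      (S₂ := ShortComplex.mk (k ≫ a.hom) g _) (Iso.refl _) a b (by simp)
      (by simpa using w.symm)) h⟩

variable [RightExactCategory E]

lemma isDeflation_of_isPullback {X Y Z W : E} {a : X ⟶ Y} {b : X ⟶ Z} {g : Y ⟶ W} {f : Z ⟶ W}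
    (sq : IsPullback a b g f) (hg : IsDeflation g) : IsDeflation b := by
  obtain ⟨X', a', b', sq', hb'⟩ := exists_pullback g f hg
  exact isDeflation_of_arrow_iso (sq'.isoIsPullback _ _ sq) (Iso.refl _) (by simp) hb'

lemma isDeflation_of_isIso {X Y : E} (f : X ⟶ Y) [IsIso f] : IsDeflation f := by
  refine isDeflation_of_isPullback (g := 𝟙 (0 : E)) (a := 0) (f := 0) ?_ isDeflation_id_zero
  exact IsPullback.of_vert_isIso ⟨by simp⟩

lemma conflation_of_isIso (S : ShortComplex E) [IsIso S.g] (h : IsZero S.X₁) :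
    conflation S := by
  have : Mono S.f := ⟨fun _ _ _ ↦ h.eq_of_tgt _ _⟩
  refine conflation_of_isDeflation S (isDeflation_of_isIso _) (fun k hk ↦ ⟨0, ?_⟩)
  rw [← cancel_mono S.g]; simp [hk]

/-- The source of an inflation has a deflation to `0`. -/
lemma isDeflation_zero_of_conflation {S : ShortComplex E} (h : conflation S) :
    IsDeflation (0 : S.X₁ ⟶ (0 : E)) := by
  have := conflation_mono h
  refine isDeflation_of_isPullback (a := S.f) (g := S.g) (f := 0) ?_ ⟨_, _, _, h⟩
  refine ⟨⟨by simp⟩, ⟨PullbackCone.IsLimit.mk _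
    (fun s ↦ (conflation_lift h s.fst (by rw [s.condition, comp_zero])).choose)
    (fun s ↦ (conflation_lift h s.fst (by rw [s.condition, comp_zero])).choose_spec)
    (fun s ↦ (isZero_zero E).eq_of_tgt _ _) (fun s m h₁ h₂ ↦ ?_)⟩⟩
  rw [← cancel_mono S.f, h₁]
  exact (conflation_lift h s.fst (by rw [s.condition, comp_zero])).choose_spec.symm

lemma conflation_id_zero {S : ShortComplex E} (h : IsDeflation (0 : S.X₁ ⟶ (0 : E)))
    [IsIso S.f] (h₃ : IsZero S.X₃) : conflation S := by
  refine conflation_of_isDeflation S ?_ (fun k _ ↦ ⟨k ≫ inv S.f, by simp⟩)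
  exact isDeflation_of_arrow_iso (asIso S.f) ((isZero_zero E).iso h₃)
    (h₃.eq_of_tgt _ _) h

end Basic

section Acyclic

variable {E : Type u} [Category.{v} E] [Preadditive E] [HasZeroObject E]
  [HasBinaryBiproducts E]

open ConflationCategory RightExactCategory

/-- A complex `K` is acyclic in degree `n` if `d : K.X (n - 1) ⟶ K.X n` factors as a deflation `p`
which is a cokernel of the previous differential, followed by an inflation `i` which is a kernel
of the next differential. -/
def IsAcyclicInDegree [ConflationCategory E] (K : CochainComplex E ℤ) (n : ℤ) : Prop :=
  ∃ (Z : E) (p : K.X (n - 1) ⟶ Z) (i : Z ⟶ K.X n)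
    (hp : K.d (n - 2) (n - 1) ≫ p = 0) (hi : i ≫ K.d n (n + 1) = 0),
    p ≫ i = K.d (n - 1) n ∧ IsDeflation p ∧ IsInflation i ∧
    Nonempty (IsColimit (CokernelCofork.ofπ p hp)) ∧ Nonempty (IsLimit (KernelFork.ofι i hi))

/-- A complex is acyclic if it is acyclic in each degree. -/
def IsAcyclic [ConflationCategory E] (K : CochainComplex E ℤ) : Prop :=
  ∀ n, IsAcyclicInDegree K n

/-- A presentation of a complex as a splicing of conflations `Z n ⟶ K.X n ⟶ Z (n + 1)`. -/
structure Splicing [ConflationCategory E] (K : CochainComplex E ℤ) where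
  Z : ℤ → E
  i (n : ℤ) : Z n ⟶ K.X n
  p (n : ℤ) : K.X n ⟶ Z (n + 1)
  w (n : ℤ) : i n ≫ p n = 0
  conf (n : ℤ) : conflation (ShortComplex.mk (i n) (p n) (w n))
  fac (n : ℤ) : p n ≫ i (n + 1) = K.d n (n + 1)

lemma IsAcyclic.splicing [ConflationCategory E] {K : CochainComplex E ℤ} (hK : IsAcyclic K) :
    Nonempty (Splicing K) := by
  have H : ∀ n : ℤ, ∃ (Z : E) (p : ∀ m, m + 1 = n → (K.X m ⟶ Z)) (i : Z ⟶ K.X n),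
      i ≫ K.d n (n + 1) = 0 ∧ (∀ m hm, p m hm ≫ i = K.d m n ∧ IsDeflation (p m hm)) ∧ Mono i ∧
      (∀ {T : E} (k : T ⟶ K.X n), k ≫ K.d n (n + 1) = 0 → ∃ l : T ⟶ Z, l ≫ i = k) := by
    intro n
    obtain ⟨Z, p, i, hp, hi, fac, hp', hi', -, ⟨hi''⟩⟩ := hK n
    refine ⟨Z, fun m hm ↦ eqToHom (by congr 1; lia) ≫ p, i, hi, ?_, Fork.IsLimit.mono hi'',
      fun k hk ↦ ⟨hi''.lift (KernelFork.ofι k hk), hi''.fac _ WalkingParallelPair.zero⟩⟩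
    intro m hm
    obtain rfl : m = n - 1 := by lia
    simpa using ⟨fac, hp'⟩
  choose Z p i hi hp hmono hlift using H
  have w (n : ℤ) : i n ≫ p (n + 1) n rfl = 0 := by
    have := hmono (n + 1)
    rw [← cancel_mono (i (n + 1)), Category.assoc, (hp (n + 1) n rfl).1, hi, zero_comp]
  refine ⟨⟨Z, i, fun n ↦ p (n + 1) n rfl, w, fun n ↦ ?_, fun n ↦ (hp (n + 1) n rfl).1⟩⟩
  have : Mono (ShortComplex.mk (i n) (p (n + 1) n rfl) (w n)).f := hmono n
  refine conflation_of_isDeflation _ (hp (n + 1) n rfl).2 (fun {T} k hk ↦ hlift n k ?_)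
  dsimp at k hk
  rw [← (hp (n + 1) n rfl).1, reassoc_of% hk, zero_comp]

lemma Splicing.isAcyclic [ConflationCategory E] {K : CochainComplex E ℤ} (s : Splicing K) :
    IsAcyclic K := by
  intro n
  obtain ⟨m, rfl⟩ : ∃ m, n = m + 1 := ⟨n - 1, by lia⟩
  obtain ⟨l, rfl⟩ : ∃ l, m = l + 1 := ⟨m - 1, by lia⟩
  suffices ∀ (a b : ℤ) (_ : a = l + 1) (_ : b = l),
    ∃ (Z : E) (p : K.X a ⟶ Z) (i : Z ⟶ K.X (l + 1 + 1))
      (hp : K.d b a ≫ p = 0) (hi : i ≫ K.d (l + 1 + 1) (l + 1 + 1 + 1) = 0),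
      p ≫ i = K.d a (l + 1 + 1) ∧ IsDeflation p ∧ IsInflation i ∧
      Nonempty (IsColimit (CokernelCofork.ofπ p hp)) ∧
      Nonempty (IsLimit (KernelFork.ofι i hi)) from this _ _ (by lia) (by lia)
  rintro a b rfl rfl
  have hm := conflation_mono (s.conf (b + 1 + 1))
  have hm' := conflation_mono (s.conf (b + 1 + 1 + 1))
  have he := conflation_epi (s.conf b)
  have he' := conflation_epi (s.conf (b + 1))
  dsimp at hm hm' he he'
  refine ⟨s.Z (b + 1 + 1), s.p (b + 1), s.i (b + 1 + 1), ?_, ?_, s.fac _, ⟨_, _, _, s.conf _⟩,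
    ⟨_, _, _, s.conf _⟩, ⟨?_⟩, ⟨?_⟩⟩
  · rw [← s.fac, Category.assoc, s.w, comp_zero]
  · rw [← s.fac, reassoc_of% s.w, zero_comp]
  · have H {T : E} (k : K.X (b + 1) ⟶ T) (hk : K.d b (b + 1) ≫ k = 0) :
        ∃ l, s.p (b + 1) ≫ l = k :=
      conflation_desc (s.conf (b + 1)) k (by
        dsimp; rw [← cancel_epi (s.p b), ← Category.assoc, s.fac, hk, comp_zero])
    exact CokernelCofork.IsColimit.ofπ _ _ (fun k hk ↦ (H k hk).choose)
      (fun k hk ↦ (H k hk).choose_spec)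
      (fun k hk m hm ↦ by rw [← cancel_epi (s.p (b + 1)), hm, (H k hk).choose_spec])
  · have H {T : E} (k : T ⟶ K.X (b + 1 + 1)) (hk : k ≫ K.d (b + 1 + 1) (b + 1 + 1 + 1) = 0) :
        ∃ l, l ≫ s.i (b + 1 + 1) = k :=
      conflation_lift (s.conf (b + 1 + 1)) k (by
        dsimp; rw [← cancel_mono (s.i (b + 1 + 1 + 1)), Category.assoc, s.fac, hk, zero_comp])
    exact KernelFork.IsLimit.ofι _ _ (fun k hk ↦ (H k hk).choose)
      (fun k hk ↦ (H k hk).choose_spec)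
      (fun k hk m hm ↦ by rw [← cancel_mono (s.i (b + 1 + 1)), hm, (H k hk).choose_spec])

end Acyclic

section Cone

variable {E : Type u} [Category.{v} E] [Preadditive E] [HasZeroObject E]
  [HasBinaryBiproducts E] [RightExactCategory E]

open ConflationCategory RightExactCategory CochainComplex HomComplex

lemma Splicing.cone {X Y : CochainComplex E ℤ} (s : Splicing X) (t : Splicing Y) (φ : X ⟶ Y) :
    Nonempty (Splicing (mappingCone φ)) := by
  have hsi (n : ℤ) : Mono (s.i n) := conflation_mono (s.conf n)
  have hti (n : ℤ) : Mono (t.i n) := conflation_mono (t.conf n)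
  have hsp (n : ℤ) : Epi (s.p n) := conflation_epi (s.conf n)
  have hζ (n : ℤ) : ∃ ζ : s.Z n ⟶ t.Z n, ζ ≫ t.i n = s.i n ≫ φ.f n := by
    refine conflation_lift (t.conf n) _ ?_
    dsimp
    rw [← cancel_mono (t.i (n + 1)), Category.assoc, Category.assoc, t.fac, φ.comm, ← s.fac,
      Category.assoc, reassoc_of% s.w, zero_comp, zero_comp]
  choose ζ hζ using hζ
  have hζ' (n : ℤ) : s.p n ≫ ζ (n + 1) = φ.f n ≫ t.p n := by
    rw [← cancel_mono (t.i (n + 1)), Category.assoc, Category.assoc, t.fac, hζ, φ.comm, ← s.fac,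
      Category.assoc]
  have hP (n : ℤ) := exists_pullback (t.p n) (-ζ (n + 1)) ⟨_, _, _, t.conf n⟩
  choose P a b sq hb using hP
  have hab (n : ℤ) : a n ≫ t.p n = - (b n ≫ ζ (n + 1)) := by rw [(sq n).w]; simp
  -- the inclusion of cycles
  let I (n : ℤ) : P n ⟶ (mappingCone φ).X n :=
    (b n ≫ s.i (n + 1)) ≫ (mappingCone.inl φ).v (n + 1) n (by lia) +
      a n ≫ (mappingCone.inr φ).f n
  have hI₁ (n : ℤ) : I n ≫ (mappingCone.fst φ).1.v n (n + 1) rfl = b n ≫ s.i (n + 1) := by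
    simp [I]
  have hI₂ (n : ℤ) : I n ≫ (mappingCone.snd φ).v n n (add_zero n) = a n := by
    simp [I]
  have hImono (n : ℤ) : Mono (I n) := by
    refine Preadditive.mono_of_cancel_zero _ (fun {T} g hg ↦ (sq n).hom_ext ?_ ?_)
    · rw [← hI₂, reassoc_of% hg, zero_comp, zero_comp]
    · rw [← cancel_mono (s.i (n + 1)), Category.assoc, ← hI₁, reassoc_of% hg]; simp
  -- the projection to the cycles
  have hQ (n : ℤ) : ∃ q : (mappingCone φ).X n ⟶ P (n + 1),
      q ≫ a (n + 1) = (mappingCone.fst φ).1.v n (n + 1) rfl ≫ φ.f (n + 1) +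
        (mappingCone.snd φ).v n n (add_zero n) ≫ Y.d n (n + 1) ∧
      q ≫ b (n + 1) = - ((mappingCone.fst φ).1.v n (n + 1) rfl ≫ s.p (n + 1)) := by
    refine ⟨(sq (n + 1)).lift _ _ ?_, (sq (n + 1)).lift_fst _ _ _, (sq (n + 1)).lift_snd _ _ _⟩
    rw [Preadditive.add_comp, Category.assoc, Category.assoc, ← hζ', ← t.fac, Category.assoc, t.w]
    simp
  choose q hqa hqb using hQ
  have hfac (n : ℤ) : q n ≫ I (n + 1) = (mappingCone φ).d n (n + 1) := by
    rw [mappingCone.ext_to_iff _ (n + 1) (n + 1 + 1) rfl]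
    constructor
    · rw [Category.assoc, hI₁, reassoc_of% (hqb n), mappingCone.d_fst_v _ n (n + 1) (n + 1 + 1) rfl rfl]
      simp [s.fac]
    · rw [Category.assoc, hI₂, hqa, mappingCone.d_snd_v _ n (n + 1) rfl]
  have hw (n : ℤ) : I n ≫ q n = 0 := by
    apply (sq (n + 1)).hom_ext
    · rw [Category.assoc, hqa, Preadditive.comp_add, reassoc_of% (hI₁ n), reassoc_of% (hI₂ n),
        ← t.fac, reassoc_of% (hab n), ← hζ]
      simp
    · rw [Category.assoc, hqb, Preadditive.comp_neg, reassoc_of% (hI₁ n), s.w]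
      simp
  have hker (n : ℤ) {T : E} (k : T ⟶ (mappingCone φ).X n) (hk : k ≫ q n = 0) :
      ∃ l : T ⟶ P n, l ≫ I n = k := by
    have h₁ : (k ≫ (mappingCone.fst φ).1.v n (n + 1) rfl) ≫ s.p (n + 1) = 0 := by
      have := hqb n
      rw [← neg_eq_zero, Category.assoc, ← Preadditive.comp_neg, ← this, reassoc_of% hk, zero_comp]
    obtain ⟨z, hz⟩ := conflation_lift (s.conf (n + 1)) _ h₁
    dsimp at hz
    have h₂ : (k ≫ (mappingCone.snd φ).v n n (add_zero n)) ≫ t.p n = z ≫ (-ζ (n + 1)) := by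
      have h₃ : k ≫ q n ≫ a (n + 1) = 0 := by rw [reassoc_of% hk, zero_comp]
      rw [hqa, Preadditive.comp_add, ← Category.assoc, ← hz, Category.assoc, ← hζ,
        ← t.fac] at h₃
      rw [← cancel_mono (t.i (n + 1))]
      simp only [Category.assoc, Preadditive.comp_neg, Preadditive.neg_comp]
      rw [eq_neg_iff_add_eq_zero]
      exact (add_comm _ _).trans h₃
    refine ⟨(sq n).lift _ _ h₂, ?_⟩
    rw [mappingCone.ext_to_iff _ n (n + 1) rfl]
    constructor
    · rw [Category.assoc, hI₁, (sq n).lift_snd_assoc, hz]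
    · rw [Category.assoc, hI₂, (sq n).lift_fst]
  have hdefl (n : ℤ) : IsDeflation (q n) := by
    -- `q n` is the composition of two pullbacks of deflations
    let u : (mappingCone φ).X n ⟶ X.X (n + 1) ⊞ t.Z (n + 1) :=
      biprod.lift ((mappingCone.fst φ).1.v n (n + 1) rfl)
        ((mappingCone.snd φ).v n n (add_zero n) ≫ t.p n)
    have hu : IsDeflation u := by
      refine isDeflation_of_isPullback (a := (mappingCone.snd φ).v n n (add_zero n))
        (f := biprod.snd) (g := t.p n) ?_ ⟨_, _, _, t.conf n⟩
      refine ⟨⟨by simp [u]⟩, ⟨PullbackCone.IsLimit.mk _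
        (fun c ↦ (c.snd ≫ biprod.fst) ≫ (mappingCone.inl φ).v (n + 1) n (by lia) +
          c.fst ≫ (mappingCone.inr φ).f n) (fun c ↦ by simp) (fun c ↦ ?_) (fun c m h₁ h₂ ↦ ?_)⟩⟩
      · apply biprod.hom_ext
        · simp [u]
        · simp [u, c.condition]
      · rw [mappingCone.ext_to_iff _ n (n + 1) rfl]
        constructor
        · rw [← h₂]; simp [u]
        · rw [h₁]; simp
    have hv : ∃ v : X.X (n + 1) ⊞ t.Z (n + 1) ⟶ P (n + 1),
        v ≫ a (n + 1) = biprod.fst ≫ φ.f (n + 1) + biprod.snd ≫ t.i (n + 1) ∧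
        v ≫ b (n + 1) = - (biprod.fst ≫ s.p (n + 1)) := by
      refine ⟨(sq (n + 1)).lift _ _ ?_, (sq (n + 1)).lift_fst _ _ _, (sq (n + 1)).lift_snd _ _ _⟩
      rw [Preadditive.add_comp, Category.assoc, Category.assoc, ← hζ', t.w]
      simp
    obtain ⟨v, hva, hvb⟩ := hv
    have hvd : IsDeflation v := by
      have hneg : IsDeflation (- s.p (n + 1)) :=
        isDeflation_of_arrow_iso (f := s.p (n + 1)) (Iso.refl _) (-(Iso.refl _)) (by simp)
          ⟨_, _, _, s.conf (n + 1)⟩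
      refine isDeflation_of_isPullback (a := biprod.fst) (f := b (n + 1)) ?_ hneg
      have H (c : PullbackCone (- s.p (n + 1)) (b (n + 1))) :
          ∃ z, z ≫ t.i (n + 1) = c.snd ≫ a (n + 1) - c.fst ≫ φ.f (n + 1) := by
        refine conflation_lift (t.conf (n + 1)) _ ?_
        dsimp
        rw [Preadditive.sub_comp, Category.assoc, Category.assoc, hab, ← hζ',
          Preadditive.comp_neg, ← c.condition_assoc]
        simp
      have key (c : PullbackCone (- s.p (n + 1)) (b (n + 1))) :
          biprod.lift c.fst (H c).choose ≫ v = c.snd := by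
        apply (sq (n + 1)).hom_ext
        · simp [hva, (H c).choose_spec]
        · simp [hvb, ← c.condition]
      refine ⟨⟨by simp [hvb]⟩, ⟨PullbackCone.IsLimit.mk _
        (fun c ↦ biprod.lift c.fst (H c).choose) (fun c ↦ by simp) key (fun c m h₁ h₂ ↦ ?_)⟩⟩
      apply biprod.hom_ext
      · simpa using h₁
      · rw [biprod.lift_snd, ← cancel_mono (t.i (n + 1)), (H c).choose_spec, ← h₂, ← h₁]
        simp [hva]
    have : q n = u ≫ v := by
      apply (sq (n + 1)).hom_ext
      · rw [hqa, Category.assoc, hva]; simp [u, t.fac]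
      · rw [hqb, Category.assoc, hvb]; simp [u]
    rw [this]
    exact isDeflation_comp _ _ hu hvd
  refine ⟨⟨P, I, q, hw, fun n ↦ ?_, hfac⟩⟩
  have : Mono (ShortComplex.mk (I n) (q n) (hw n)).f := hImono n
  exact conflation_of_isDeflation _ (hdefl n) (fun k hk ↦ hker n k hk)

/-- The mapping cone of a morphism between acyclic complexes is acyclic. -/
lemma IsAcyclic.mappingCone {X Y : CochainComplex E ℤ} (hX : IsAcyclic X) (hY : IsAcyclic Y)
    (φ : X ⟶ Y) : IsAcyclic (mappingCone φ) := by
  obtain ⟨s⟩ := hX.splicing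
  obtain ⟨t⟩ := hY.splicing
  obtain ⟨r⟩ := s.cone t φ
  exact r.isAcyclic

end Cone

section Truncation

variable {E : Type u} [Category.{v} E] [Preadditive E] [HasZeroObject E]
  [HasBinaryBiproducts E] [RightExactCategory E]

open ConflationCategory RightExactCategory

/-- A morphism from an acyclic complex to a complex in degrees `≥ 0` factors through an acyclic
complex in degrees `≥ 0`. -/
lemma IsAcyclic.exists_fac_ge {X Y : CochainComplex E ℤ} (hX : IsAcyclic X)
    [Y.IsStrictlyGE 0] (f : X ⟶ Y) :
    ∃ (W : CochainComplex E ℤ) (_ : W.IsStrictlyGE 0) (a : X ⟶ W) (b : W ⟶ Y),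
      IsAcyclic W ∧ a ≫ b = f := by
  obtain ⟨s⟩ := hX.splicing
  have hsi (n : ℤ) : Mono (s.i n) := conflation_mono (s.conf n)
  have hsp (n : ℤ) : Epi (s.p n) := conflation_epi (s.conf n)
  have hY (k : ℕ) : IsZero (Y.X (Int.negSucc k)) := Y.isZero_of_isStrictlyGE 0 _ (by lia)
  let WX : ℤ → E
    | Int.ofNat 0 => s.Z 1
    | Int.ofNat (k + 1) => X.X (Int.ofNat (k + 1))
    | Int.negSucc _ => 0
  let Wd : ∀ n : ℤ, WX n ⟶ WX (n + 1)
    | Int.ofNat 0 => s.i 1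
    | Int.ofNat (k + 1) => X.d (Int.ofNat (k + 1)) (Int.ofNat (k + 1 + 1))
    | Int.negSucc _ => 0
  have Wsq : ∀ n : ℤ, Wd n ≫ Wd (n + 1) = 0
    | Int.ofNat 0 => by
        change s.i 1 ≫ X.d 1 (1 + 1) = 0
        rw [← s.fac 1, reassoc_of% s.w, zero_comp]
    | Int.ofNat (k + 1) => X.d_comp_d _ _ _
    | Int.negSucc _ => zero_comp
  let W : CochainComplex E ℤ := CochainComplex.of WX Wd Wsq
  have hWd (n : ℤ) : W.d n (n + 1) = Wd n := CochainComplex.of_d ..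
  let WZ : ℤ → E
    | Int.ofNat 0 => 0
    | Int.ofNat (k + 1) => s.Z (Int.ofNat (k + 1))
    | Int.negSucc _ => 0
  let Wi : ∀ n : ℤ, WZ n ⟶ WX n
    | Int.ofNat 0 => 0
    | Int.ofNat (k + 1) => s.i (Int.ofNat (k + 1))
    | Int.negSucc _ => 0
  let Wp : ∀ n : ℤ, WX n ⟶ WZ (n + 1)
    | Int.ofNat 0 => 𝟙 (s.Z 1)
    | Int.ofNat (k + 1) => s.p (Int.ofNat (k + 1))
    | Int.negSucc _ => 0
  have Ww : ∀ n : ℤ, Wi n ≫ Wp n = 0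
    | Int.ofNat 0 => zero_comp
    | Int.ofNat (k + 1) => s.w _
    | Int.negSucc _ => zero_comp
  have Wconf : ∀ n : ℤ, conflation (ShortComplex.mk (Wi n) (Wp n) (Ww n))
    | Int.ofNat 0 => by
        have : IsIso (ShortComplex.mk (Wi 0) (Wp 0) (Ww 0)).g :=
          inferInstanceAs (IsIso (𝟙 (s.Z 1)))
        exact conflation_of_isIso _ (isZero_zero E)
    | Int.ofNat (k + 1) => s.conf _
    | Int.negSucc k => by
        have h₀ : ∀ l : ℕ, WZ (Int.negSucc l + 1) = 0 := fun l ↦ by cases l <;> rfl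
        have : IsIso (ShortComplex.mk (Wi (Int.negSucc k)) (Wp (Int.negSucc k)) (Ww (Int.negSucc k))).g :=
          (isZero_zero E).isIso (by dsimp; rw [h₀]; exact isZero_zero E) _
        exact conflation_of_isIso _ (isZero_zero E)
  have Wfac : ∀ n : ℤ, Wp n ≫ Wi (n + 1) = W.d n (n + 1)
    | Int.ofNat 0 => (Category.id_comp _).trans (hWd 0).symm
    | Int.ofNat (k + 1) => (s.fac _).trans (hWd (Int.ofNat (k + 1))).symm
    | Int.negSucc k => zero_comp.trans (hWd (Int.negSucc k)).symm
  have hW : IsAcyclic W := Splicing.isAcyclic ⟨WZ, Wi, Wp, Ww, Wconf, Wfac⟩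
  have hWge : W.IsStrictlyGE 0 := by
    rw [CochainComplex.isStrictlyGE_iff]
    intro n hn
    obtain ⟨k, rfl⟩ := Int.eq_negSucc_of_lt_zero hn
    exact isZero_zero E
  let af : ∀ n : ℤ, X.X n ⟶ WX n
    | Int.ofNat 0 => s.p 0
    | Int.ofNat (k + 1) => 𝟙 _
    | Int.negSucc _ => 0
  have ha : ∀ n : ℤ, af n ≫ Wd n = X.d n (n + 1) ≫ af (n + 1)
    | Int.ofNat 0 => (s.fac 0).trans (Category.comp_id _).symm
    | Int.ofNat (k + 1) => (Category.id_comp _).trans (Category.comp_id _).symm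
    | Int.negSucc 0 => by
        change 0 ≫ _ = X.d (-1) (-1 + 1) ≫ s.p (-1 + 1)
        rw [← s.fac, Category.assoc, s.w, zero_comp, comp_zero]
    | Int.negSucc (k + 1) => zero_comp.trans comp_zero.symm
  have h₀ : s.i 0 ≫ f.f 0 = 0 := by
    have h : X.d (-1) 0 = s.p (-1) ≫ s.i 0 := (s.fac (-1)).symm
    have : Epi (s.p (-1)) := hsp _
    have h' : s.p (-1) ≫ s.i 0 ≫ f.f 0 = s.p (-1) ≫ 0 := by
      have h'' : f.f (-1) = 0 := (hY 0).eq_of_tgt _ _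
      rw [← Category.assoc, ← h, ← f.comm, h'', zero_comp, comp_zero]
    exact (cancel_epi (s.p (-1))).1 h'
  obtain ⟨b₀ : s.Z 1 ⟶ Y.X 0, hb₀ : s.p 0 ≫ b₀ = f.f 0⟩ := conflation_desc (s.conf 0) _ h₀
  let bf : ∀ n : ℤ, WX n ⟶ Y.X n
    | Int.ofNat 0 => b₀
    | Int.ofNat (k + 1) => f.f _
    | Int.negSucc _ => 0
  have hb : ∀ n : ℤ, bf n ≫ Y.d n (n + 1) = Wd n ≫ bf (n + 1)
    | Int.ofNat 0 => by
        change b₀ ≫ Y.d 0 1 = s.i 1 ≫ f.f 1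
        have : Epi (s.p 0) := hsp _
        refine (cancel_epi (s.p 0)).1 ?_
        have h : s.p 0 ≫ s.i 1 = X.d 0 1 := s.fac 0
        rw [reassoc_of% hb₀, f.comm, reassoc_of% h]
    | Int.ofNat (k + 1) => f.comm _ _
    | Int.negSucc _ => (isZero_zero E).eq_of_src _ _
  let a : X ⟶ W := { f := af, comm' := by rintro i _ rfl; rw [hWd]; exact ha i }
  let b : W ⟶ Y := { f := bf, comm' := by rintro i _ rfl; rw [hWd]; exact hb i }
  refine ⟨W, hWge, a, b, hW, ?_⟩
  ext n
  match n with
  | Int.ofNat 0 => exact hb₀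
  | Int.ofNat (k + 1) => exact Category.id_comp _
  | Int.negSucc k => exact (hY k).eq_of_tgt _ _

/-- A morphism from a complex in degrees `≤ 0` to an acyclic complex factors through an acyclic
complex in degrees `≤ 0`. -/
lemma IsAcyclic.exists_fac_le {X Y : CochainComplex E ℤ} (hX : IsAcyclic X)
    [Y.IsStrictlyLE 0] (f : Y ⟶ X) :
    ∃ (W : CochainComplex E ℤ) (_ : W.IsStrictlyLE 0) (a : Y ⟶ W) (b : W ⟶ X),
      IsAcyclic W ∧ (∀ n ≤ 0, X.IsStrictlyGE n → W.IsStrictlyGE n) ∧ a ≫ b = f := by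
  obtain ⟨s⟩ := hX.splicing
  have hsi (n : ℤ) : Mono (s.i n) := conflation_mono (s.conf n)
  have hsp (n : ℤ) : Epi (s.p n) := conflation_epi (s.conf n)
  have hY (k : ℕ) : IsZero (Y.X (Int.ofNat (k + 1))) :=
    Y.isZero_of_isStrictlyLE 0 _ (by simp)
  let WX : ℤ → E
    | Int.ofNat 0 => s.Z 0
    | Int.ofNat (k + 1) => 0
    | Int.negSucc k => X.X (Int.negSucc k)
  let Wd : ∀ n : ℤ, WX n ⟶ WX (n + 1)
    | Int.ofNat _ => 0
    | Int.negSucc 0 => s.p (Int.negSucc 0)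
    | Int.negSucc (k + 1) => X.d (Int.negSucc (k + 1)) (Int.negSucc k)
  have Wsq : ∀ n : ℤ, Wd n ≫ Wd (n + 1) = 0
    | Int.ofNat _ => zero_comp
    | Int.negSucc 0 => comp_zero
    | Int.negSucc 1 => by
        change X.d (Int.negSucc 1) (Int.negSucc 0) ≫ s.p (Int.negSucc 0) = 0
        rw [show X.d (Int.negSucc 1) (Int.negSucc 0) = s.p (Int.negSucc 1) ≫ s.i (Int.negSucc 0) from (s.fac (Int.negSucc 1)).symm, Category.assoc,
          s.w, comp_zero]
    | Int.negSucc (k + 2) => X.d_comp_d _ _ _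
  let W : CochainComplex E ℤ := CochainComplex.of WX Wd Wsq
  have hWd (n : ℤ) : W.d n (n + 1) = Wd n := CochainComplex.of_d ..
  let WZ : ℤ → E
    | Int.ofNat 0 => s.Z 0
    | Int.ofNat (k + 1) => 0
    | Int.negSucc k => s.Z (Int.negSucc k)
  let Wi : ∀ n : ℤ, WZ n ⟶ WX n
    | Int.ofNat 0 => 𝟙 (s.Z 0)
    | Int.ofNat (k + 1) => 0
    | Int.negSucc k => s.i (Int.negSucc k)
  let Wp : ∀ n : ℤ, WX n ⟶ WZ (n + 1)
    | Int.ofNat _ => 0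
    | Int.negSucc 0 => s.p (Int.negSucc 0)
    | Int.negSucc (k + 1) => s.p (Int.negSucc (k + 1))
  have Ww : ∀ n : ℤ, Wi n ≫ Wp n = 0
    | Int.ofNat _ => comp_zero
    | Int.negSucc 0 => s.w (Int.negSucc 0)
    | Int.negSucc (k + 1) => s.w (Int.negSucc (k + 1))
  have Wconf : ∀ n : ℤ, conflation (ShortComplex.mk (Wi n) (Wp n) (Ww n))
    | Int.ofNat 0 => by
        have : IsIso (ShortComplex.mk (Wi 0) (Wp 0) (Ww 0)).f :=
          inferInstanceAs (IsIso (𝟙 (s.Z 0)))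
        have h : IsDeflation (0 : s.Z 0 ⟶ (0 : E)) := isDeflation_zero_of_conflation (s.conf 0)
        exact conflation_id_zero h (isZero_zero E)
    | Int.ofNat (k + 1) => by
        have : IsIso (ShortComplex.mk (Wi (Int.ofNat (k + 1))) (Wp (Int.ofNat (k + 1))) (Ww (Int.ofNat (k + 1)))).g :=
          (isZero_zero E).isIso (isZero_zero E) _
        exact conflation_of_isIso _ (isZero_zero E)
    | Int.negSucc 0 => s.conf _
    | Int.negSucc (k + 1) => s.conf _
  have Wfac : ∀ n : ℤ, Wp n ≫ Wi (n + 1) = W.d n (n + 1)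
    | Int.ofNat k => zero_comp.trans (hWd (Int.ofNat k)).symm
    | Int.negSucc 0 => (Category.comp_id _).trans (hWd (Int.negSucc 0)).symm
    | Int.negSucc (k + 1) => (s.fac _).trans (hWd (Int.negSucc (k + 1))).symm
  have hW : IsAcyclic W := Splicing.isAcyclic ⟨WZ, Wi, Wp, Ww, Wconf, Wfac⟩
  have hWle : W.IsStrictlyLE 0 := by
    rw [CochainComplex.isStrictlyLE_iff]
    intro n hn
    obtain ⟨k, rfl⟩ := Int.eq_ofNat_of_zero_le hn.le
    obtain ⟨l, rfl⟩ : ∃ l, k = l + 1 := ⟨k - 1, by lia⟩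
    exact isZero_zero E
  let af : ∀ n : ℤ, WX n ⟶ X.X n
    | Int.ofNat 0 => s.i 0
    | Int.ofNat (k + 1) => 0
    | Int.negSucc _ => 𝟙 _
  have ha : ∀ n : ℤ, af n ≫ X.d n (n + 1) = Wd n ≫ af (n + 1)
    | Int.ofNat 0 => by
        change s.i 0 ≫ X.d 0 (0 + 1) = 0 ≫ _
        rw [← s.fac, reassoc_of% s.w, zero_comp, zero_comp]
    | Int.ofNat (k + 1) => zero_comp.trans comp_zero.symm
    | Int.negSucc 0 => (Category.id_comp _).trans (s.fac (Int.negSucc 0)).symm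
    | Int.negSucc (k + 1) => (Category.id_comp _).trans (Category.comp_id _).symm
  have h₀ : f.f 0 ≫ s.p 0 = 0 := by
    have h : X.d 0 1 = s.p 0 ≫ s.i 1 := (s.fac 0).symm
    have : Mono (s.i 1) := hsi _
    have h' : (f.f 0 ≫ s.p 0) ≫ s.i 1 = 0 ≫ s.i 1 := by
      have h'' : f.f 1 = 0 := (hY 0).eq_of_src _ _
      rw [Category.assoc, ← h, f.comm, h'', comp_zero, zero_comp]
    exact (cancel_mono (s.i 1)).1 h'
  obtain ⟨b₀ : Y.X 0 ⟶ s.Z 0, hb₀ : b₀ ≫ s.i 0 = f.f 0⟩ := conflation_lift (s.conf 0) _ h₀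
  let bf : ∀ n : ℤ, Y.X n ⟶ WX n
    | Int.ofNat 0 => b₀
    | Int.ofNat (k + 1) => 0
    | Int.negSucc _ => f.f _
  have hb : ∀ n : ℤ, bf n ≫ Wd n = Y.d n (n + 1) ≫ bf (n + 1)
    | Int.ofNat _ => (isZero_zero E).eq_of_tgt _ _
    | Int.negSucc 0 => by
        change f.f (Int.negSucc 0) ≫ s.p (Int.negSucc 0) = Y.d (Int.negSucc 0) 0 ≫ b₀
        have : Mono (s.i 0) := hsi _
        refine (cancel_mono (s.i 0)).1 ?_
        have h : s.p (Int.negSucc 0) ≫ s.i 0 = X.d (Int.negSucc 0) 0 := s.fac (Int.negSucc 0)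
        rw [Category.assoc, Category.assoc, hb₀, h, f.comm]
    | Int.negSucc (k + 1) => f.comm _ _
  let a : W ⟶ X := { f := af, comm' := by rintro i _ rfl; rw [hWd]; exact ha i }
  let b : Y ⟶ W := { f := bf, comm' := by rintro i _ rfl; rw [hWd]; exact hb i }
  refine ⟨W, hWle, b, a, hW, ?_, ?_⟩
  · intro n hn h
    rw [CochainComplex.isStrictlyGE_iff]
    intro i hi
    obtain ⟨k, rfl⟩ := Int.eq_negSucc_of_lt_zero (by lia : i < 0)
    exact X.isZero_of_isStrictlyGE n _ hi
  · ext n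
    match n with
    | Int.ofNat 0 => exact hb₀
    | Int.ofNat (k + 1) => exact (hY k).eq_of_src _ _
    | Int.negSucc k => exact Category.comp_id _

end Truncation

section Homotopy

variable (E : Type u) [Category.{v} E] [Preadditive E] [HasZeroObject E]
  [HasBinaryBiproducts E] [RightExactCategory E]

open ConflationCategory RightExactCategory

/-- The homotopy category `K(E)` of complexes in `E`. -/
abbrev K : Type (max u v) := HomotopyCategory E (ComplexShape.up ℤ)

/-- The full subcategory `Ac(E)` of `K(E)` given by the acyclic complexes. -/
def acyclicK : ObjectProperty (K E) := fun X ↦ IsAcyclic X.as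

variable {E} in
lemma Splicing.zero : Nonempty (Splicing (0 : CochainComplex E ℤ)) := by
  have h (n : ℤ) : IsZero ((0 : CochainComplex E ℤ).X n) :=
    (HomologicalComplex.eval E _ n).map_isZero (isZero_zero _)
  refine ⟨⟨fun _ ↦ 0, fun _ ↦ 0, fun _ ↦ 0, by simp, fun n ↦ ?_, fun n ↦ (h n).eq_of_src _ _⟩⟩
  have : IsIso (ShortComplex.mk (0 : 0 ⟶ (0 : CochainComplex E ℤ).X n)
    (0 : _ ⟶ (0 : E)) (by simp)).g := (h n).isIso (isZero_zero E) _
  exact conflation_of_isIso _ (isZero_zero E)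

variable {E} in
lemma IsAcyclic.shift {X : CochainComplex E ℤ} (hX : IsAcyclic X) (a : ℤ) :
    IsAcyclic (X⟦a⟧) := by
  obtain ⟨s⟩ := hX.splicing
  have H (n m : ℤ) (h : n + 1 = m) : ∃ p : X.X n ⟶ s.Z m,
      p ≫ s.i m = X.d n m ∧ ∃ w, conflation (ShortComplex.mk (s.i n) p w) := by
    subst h
    exact ⟨s.p n, s.fac n, s.w n, s.conf n⟩
  choose p hp w hw using fun n ↦ H (n + a) (n + 1 + a) (by lia)
  refine Splicing.isAcyclic (K := X⟦a⟧) ⟨fun n ↦ s.Z (n + a), fun n ↦ s.i (n + a),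
    fun n ↦ a.negOnePow • p n, fun n ↦ ?_, fun n ↦ ?_, fun n ↦ ?_⟩
  · have := w n
    dsimp [CochainComplex.shiftFunctor_obj_X'] at this ⊢
    erw [Linear.comp_units_smul, this, smul_zero]
  · refine conflation_of_iso ?_ (hw n)
    exact ShortComplex.isoMk (Iso.refl _) (Iso.refl _) (a.negOnePow • Iso.refl _) (by simp)
      (by simp)
  · erw [Linear.units_smul_comp, hp n]
    rfl

instance : (acyclicK E).IsStableUnderShift ℤ where
  isStableUnderShiftBy a := ⟨fun X hX ↦ by
    obtain ⟨X, rfl⟩ := X.quotient_obj_surjective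
    rw [ObjectProperty.prop_shift_iff, HomotopyCategory.shift_quotient_obj]
    exact IsAcyclic.shift (X := X) hX a⟩

instance : (acyclicK E).ContainsZero where
  exists_zero := ⟨(HomotopyCategory.quotient _ _).obj 0, Functor.map_isZero _ (isZero_zero _),
    Splicing.zero.some.isAcyclic⟩

instance : (acyclicK E).IsTriangulatedClosed₃ where
  ext₃' T hT h₁ h₂ := by
    obtain ⟨f : T.obj₁.as ⟶ T.obj₂.as, hf⟩ :=
      (HomotopyCategory.quotient _ _).map_surjective T.mor₁
    exact ⟨(HomotopyCategory.quotient _ _).obj (CochainComplex.mappingCone f),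
      IsAcyclic.mappingCone h₁ h₂ f,
      ⟨Triangle.π₃.mapIso (isoTriangleOfIso₁₂ T _ hT
        (HomotopyCategory.mappingCone_triangleh_distinguished f)
        (Iso.refl _) (Iso.refl _)
        (((Category.comp_id _).trans hf.symm).trans (Category.id_comp _).symm))⟩⟩

/-- `Ac(E)` is a triangulated subcategory of `K(E)` (not closed under isomorphisms in general). -/
instance : (acyclicK E).IsTriangulated where
  toIsTriangulatedClosed₂ := .of_isTriangulatedClosed₃

/-- The derived category `D(E)`: the Verdier localization `K(E) / Ac(E)`. -/
def D : Type (max u v) := (acyclicK E).trW.Localization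

instance : Category.{max u v} (D E) := inferInstanceAs (Category (acyclicK E).trW.Localization)

/-- The localization functor `K(E) ⥤ D(E)`. -/
def Qh : K E ⥤ D E := (acyclicK E).trW.Q

instance : (Qh E).IsLocalization (acyclicK E).trW :=
  inferInstanceAs ((acyclicK E).trW.Q.IsLocalization (acyclicK E).trW)

instance : Preadditive (D E) := Localization.preadditive (Qh E) (acyclicK E).trW

instance : (Qh E).Additive := Localization.functor_additive (Qh E) (acyclicK E).trW

instance : HasZeroObject (D E) := (Qh E).hasZeroObject_of_additive

instance : HasShift (D E) ℤ := HasShift.localized (Qh E) (acyclicK E).trW ℤ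

instance : (Qh E).CommShift ℤ := Functor.CommShift.localized (Qh E) (acyclicK E).trW ℤ

instance (n : ℤ) : (shiftFunctor (D E) n).Additive := by
  rw [Localization.functor_additive_iff (Qh E) (acyclicK E).trW]
  exact Functor.additive_of_iso ((Qh E).commShiftIso n)

instance : Pretriangulated (D E) :=
  Triangulated.Localization.pretriangulated (Qh E) (acyclicK E).trW

instance : (Qh E).IsTriangulated :=
  Triangulated.Localization.isTriangulated_functor (Qh E) (acyclicK E).trW

instance : IsTriangulated (D E) :=
  Triangulated.Localization.isTriangulated (Qh E) (acyclicK E).trW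

/-- The functor `C(E) ⥤ D(E)`. -/
def Q : CochainComplex E ℤ ⥤ D E := HomotopyCategory.quotient _ _ ⋙ Qh E

/-- The functor `i : E ⥤ D(E)` mapping objects to stalk complexes in degree zero. -/
def stalk : E ⥤ D E := HomologicalComplex.single E (ComplexShape.up ℤ) 0 ⋙ Q E

end Homotopy

section Bounded

variable (E : Type u) [Category.{v} E] [Preadditive E] [HasZeroObject E]
  [HasBinaryBiproducts E]

/-- Complexes that are bounded on the right: `X.X n` is zero for `n ≫ 0`. -/
def IsRightBounded {E : Type u} [Category.{v} E] [Preadditive E] (X : CochainComplex E ℤ) : Prop :=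
  ∃ b : ℤ, X.IsStrictlyLE b

/-- Bounded complexes. -/
def IsBounded {E : Type u} [Category.{v} E] [Preadditive E] (X : CochainComplex E ℤ) : Prop :=
  (∃ a : ℤ, X.IsStrictlyGE a) ∧ ∃ b : ℤ, X.IsStrictlyLE b

variable {E}

lemma IsRightBounded.mappingCone {X Y : CochainComplex E ℤ} (hX : IsRightBounded X)
    (hY : IsRightBounded Y) (f : X ⟶ Y) : IsRightBounded (CochainComplex.mappingCone f) := by
  obtain ⟨b, _⟩ := hX
  obtain ⟨b', _⟩ := hY
  refine ⟨max b b', ?_⟩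
  rw [CochainComplex.isStrictlyLE_iff]
  intro i hi
  simp only [CochainComplex.mappingCone.isZero_X_iff]
  exact ⟨X.isZero_of_isStrictlyLE b _ (by lia), Y.isZero_of_isStrictlyLE b' _ (by lia)⟩

lemma IsBounded.mappingCone {X Y : CochainComplex E ℤ} (hX : IsBounded X)
    (hY : IsBounded Y) (f : X ⟶ Y) : IsBounded (CochainComplex.mappingCone f) := by
  refine ⟨?_, IsRightBounded.mappingCone hX.2 hY.2 f⟩
  obtain ⟨a, _⟩ := hX.1
  obtain ⟨a', _⟩ := hY.1
  exact ⟨min a a' - 1, CochainComplex.isStrictlyGE_mappingCone f a a' _ (by lia) (by lia)⟩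

lemma IsRightBounded.shift {X : CochainComplex E ℤ} (hX : IsRightBounded X) (n : ℤ) :
    IsRightBounded (X⟦n⟧) := by
  obtain ⟨b, _⟩ := hX
  exact ⟨b - n, X.isStrictlyLE_shift b n _ (by lia)⟩

lemma IsBounded.shift {X : CochainComplex E ℤ} (hX : IsBounded X) (n : ℤ) :
    IsBounded (X⟦n⟧) := by
  refine ⟨?_, IsRightBounded.shift hX.2 n⟩
  obtain ⟨a, _⟩ := hX.1
  exact ⟨a - n, X.isStrictlyGE_shift a n _ (by lia)⟩

lemma IsBounded.zero : IsBounded (0 : CochainComplex E ℤ) :=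
  ⟨⟨0, inferInstance⟩, ⟨0, inferInstance⟩⟩

variable (E)

/-- The bounded complexes, as a full subcategory of the homotopy category. -/
def boundedK : ObjectProperty (K E) := fun X ↦ IsBounded X.as

instance : (boundedK E).IsStableUnderShift ℤ where
  isStableUnderShiftBy a := ⟨fun X hX ↦ by
    obtain ⟨X, rfl⟩ := X.quotient_obj_surjective
    rw [ObjectProperty.prop_shift_iff, HomotopyCategory.shift_quotient_obj]
    exact IsBounded.shift (X := X) hX a⟩

instance : (boundedK E).ContainsZero where
  exists_zero := ⟨(HomotopyCategory.quotient _ _).obj 0, Functor.map_isZero _ (isZero_zero _),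
    IsBounded.zero⟩

instance : (boundedK E).IsTriangulatedClosed₃ where
  ext₃' T hT h₁ h₂ := by
    obtain ⟨f : T.obj₁.as ⟶ T.obj₂.as, hf⟩ :=
      (HomotopyCategory.quotient _ _).map_surjective T.mor₁
    exact ⟨(HomotopyCategory.quotient _ _).obj (CochainComplex.mappingCone f),
      IsBounded.mappingCone h₁ h₂ f,
      ⟨Triangle.π₃.mapIso (isoTriangleOfIso₁₂ T _ hT
        (HomotopyCategory.mappingCone_triangleh_distinguished f)
        (Iso.refl _) (Iso.refl _)
        (((Category.comp_id _).trans hf.symm).trans (Category.id_comp _).symm))⟩⟩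

instance : (boundedK E).IsTriangulated where
  toIsTriangulatedClosed₂ := .of_isTriangulatedClosed₃

variable [RightExactCategory E]

/-- The bounded derived category, as a full subcategory of `D(E)`: the objects which are
isomorphic in `D(E)` to a bounded complex. -/
def boundedD : ObjectProperty (D E) := fun M ↦
  ∃ X : CochainComplex E ℤ, IsBounded X ∧ Nonempty (M ≅ (Q E).obj X)

variable {E}

lemma exists_fac_plus {X Y : K E} (hX : acyclicK E X) (hY : HomotopyCategory.plus E Y)
    (f : X ⟶ Y) : ∃ (W : K E) (a : X ⟶ W) (b : W ⟶ Y),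
      HomotopyCategory.plus E W ∧ acyclicK E W ∧ a ≫ b = f := by
  obtain ⟨X, rfl⟩ := X.quotient_obj_surjective
  obtain ⟨Y, rfl⟩ := Y.quotient_obj_surjective
  obtain ⟨f, rfl⟩ := (HomotopyCategory.quotient _ _).map_surjective f
  rw [HomotopyCategory.plus_quotient_obj_iff] at hY
  obtain ⟨m, hm⟩ := hY
  have : CochainComplex.IsStrictlyGE (Y⟦m⟧) 0 :=
    CochainComplex.isStrictlyGE_shift Y m m 0 (by lia)
  obtain ⟨W, hW, a, b, hW', fac⟩ := (IsAcyclic.shift (X := X) hX m).exists_fac_ge (f⟦m⟧')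
  refine ⟨(HomotopyCategory.quotient _ _).obj (W⟦-m⟧), (HomotopyCategory.quotient _ _).map
    ((shiftFunctorCompIsoId _ m (-m) (add_neg_cancel m)).inv.app X ≫ a⟦-m⟧'),
    (HomotopyCategory.quotient _ _).map
    (b⟦-m⟧' ≫ (shiftFunctorCompIsoId _ m (-m) (add_neg_cancel m)).hom.app Y), ?_,
    IsAcyclic.shift hW' (-m), ?_⟩
  · rw [HomotopyCategory.plus_quotient_obj_iff]
    exact ⟨m, W.isStrictlyGE_shift 0 (-m) m (by lia)⟩
  · rw [← Functor.map_comp, Category.assoc, ← Functor.map_comp_assoc, fac, shift_shift_neg']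
    simp

lemma exists_fac_bounded {X Y : K E} (hX : acyclicK E X) (hX' : HomotopyCategory.plus E X)
    (hY : boundedK E Y) (f : Y ⟶ X) : ∃ (W : K E) (a : Y ⟶ W) (b : W ⟶ X),
      boundedK E W ∧ acyclicK E W ∧ a ≫ b = f := by
  obtain ⟨X, rfl⟩ := X.quotient_obj_surjective
  obtain ⟨Y, rfl⟩ := Y.quotient_obj_surjective
  obtain ⟨f, rfl⟩ := (HomotopyCategory.quotient _ _).map_surjective f
  rw [HomotopyCategory.plus_quotient_obj_iff] at hX'
  obtain ⟨n, hn⟩ := hX'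
  obtain ⟨m, hm⟩ := hY.2
  change CochainComplex.IsStrictlyLE Y m at hm
  have : CochainComplex.IsStrictlyLE (Y⟦m⟧) 0 :=
    CochainComplex.isStrictlyLE_shift Y m m 0 (by lia)
  obtain ⟨W, hW, a, b, hW', hW'', fac⟩ := (IsAcyclic.shift (X := X) hX m).exists_fac_le (f⟦m⟧')
  refine ⟨(HomotopyCategory.quotient _ _).obj (W⟦-m⟧), (HomotopyCategory.quotient _ _).map
    ((shiftFunctorCompIsoId _ m (-m) (add_neg_cancel m)).inv.app Y ≫ a⟦-m⟧'),
    (HomotopyCategory.quotient _ _).map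
    (b⟦-m⟧' ≫ (shiftFunctorCompIsoId _ m (-m) (add_neg_cancel m)).hom.app X), ?_,
    IsAcyclic.shift hW' (-m), ?_⟩
  · refine IsBounded.shift ⟨⟨min 0 (n - m), hW'' _ (by lia) ?_⟩, ⟨0, hW⟩⟩ (-m)
    have : CochainComplex.IsStrictlyGE X (min 0 (n - m) + m) :=
      CochainComplex.isStrictlyGE_of_ge X _ n (by lia)
    exact CochainComplex.isStrictlyGE_shift X (min 0 (n - m) + m) m (min 0 (n - m)) (by lia)
  · rw [← Functor.map_comp, Category.assoc, ← Functor.map_comp_assoc, fac, shift_shift_neg']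
    simp

lemma plus_of_boundedK {X : K E} (hX : boundedK E X) : HomotopyCategory.plus E X := by
  obtain ⟨X, rfl⟩ := X.quotient_obj_surjective
  rw [HomotopyCategory.plus_quotient_obj_iff]
  exact hX.1

/-- A morphism in `D(E)` between bounded complexes is represented by a fraction which involves
bounded complexes only. -/
lemma exists_bounded_leftFraction {X Z : K E} (hX : boundedK E X) (hZ : boundedK E Z)
    (w : (Qh E).obj Z ⟶ (Qh E).obj X) :
    ∃ (Y : K E) (s : X ⟶ Y) (g : Z ⟶ Y), (boundedK E).isoClosure Y ∧
      IsIso ((Qh E).map s) ∧ w ≫ (Qh E).map s = (Qh E).map g := by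
  obtain ⟨φ, hφ⟩ := Localization.exists_leftFraction (Qh E) (acyclicK E).trW w
  obtain ⟨E', π, δ, hT, hE'⟩ := φ.hs
  obtain ⟨E'', α, β, hE''p, hE'', fac⟩ := exists_fac_plus hE'
    ((HomotopyCategory.plus E).le_shift 1 _ (plus_of_boundedK hX)) δ
  obtain ⟨Y'', s'', π'', hT''⟩ := distinguished_cocone_triangle₂ β
  obtain ⟨y : φ.Y' ⟶ Y'', hy₁ : φ.s ≫ y = 𝟙 X ≫ s'', hy₂ : π ≫ α = y ≫ π''⟩ :=
    complete_distinguished_triangle_morphism₂ _ _ hT hT'' (𝟙 X) α (by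
      change δ ≫ (𝟙 X)⟦(1 : ℤ)⟧' = α ≫ β
      rw [CategoryTheory.Functor.map_id, Category.comp_id, fac])
  obtain ⟨W, k, c, hW, hW', fac'⟩ := exists_fac_bounded hE'' hE''p hZ (φ.f ≫ y ≫ π'')
  obtain ⟨Y, s, q, hY⟩ := distinguished_cocone_triangle₂ (c ≫ β)
  obtain ⟨η : Y ⟶ Y'', hη₁ : s ≫ η = 𝟙 X ≫ s'', hη₂ : q ≫ c = η ≫ π''⟩ :=
    complete_distinguished_triangle_morphism₂ _ _ hY hT'' (𝟙 X) c (by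
      change (c ≫ β) ≫ (𝟙 X)⟦(1 : ℤ)⟧' = c ≫ β
      rw [CategoryTheory.Functor.map_id, Category.comp_id])
  rw [Category.id_comp] at hy₁ hη₁
  obtain ⟨h : Z ⟶ Y, hh : k = h ≫ q⟩ := Triangle.coyoneda_exact₃ _ hY k (by
    change k ≫ c ≫ β = 0
    have h₀ : π'' ≫ β = 0 := comp_distTriang_mor_zero₂₃ _ hT''
    rw [reassoc_of% fac', h₀]
    simp)
  obtain ⟨x : Z ⟶ X, hx : h ≫ η - φ.f ≫ y = x ≫ s''⟩ :=
    Triangle.coyoneda_exact₂ _ hT'' (h ≫ η - φ.f ≫ y) (by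
      change (h ≫ η - φ.f ≫ y) ≫ π'' = 0
      rw [Preadditive.sub_comp, Category.assoc, ← hη₂, ← reassoc_of% hh, fac']
      simp)
  have hs'' : IsIso ((Qh E).map s'') :=
    Localization.inverts (Qh E) (acyclicK E).trW _ ⟨_, _, _, hT'', hE''⟩
  have hs : IsIso ((Qh E).map s) :=
    Localization.inverts (Qh E) (acyclicK E).trW _ ⟨_, _, _, hY, hW'⟩
  have hη : IsIso ((Qh E).map η) := by
    have : IsIso ((Qh E).map s ≫ (Qh E).map η) := by rwa [← Functor.map_comp, hη₁]
    exact IsIso.of_isIso_comp_left ((Qh E).map s) _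
  refine ⟨Y, s, h - x ≫ s, ?_, hs, ?_⟩
  · exact (boundedK E).ext_of_isTriangulatedClosed₂' _ hY hX hW
  · have h₁ : w ≫ (Qh E).map φ.s = (Qh E).map φ.f := by
      rw [hφ]; simp
    rw [← cancel_mono ((Qh E).map η), Category.assoc, ← Functor.map_comp, ← Functor.map_comp, hη₁,
      ← hy₁, Functor.map_comp, reassoc_of% h₁, ← Functor.map_comp, Preadditive.sub_comp,
      Category.assoc, hη₁, ← hx]
    simp

variable (E)

instance : (boundedD E).IsClosedUnderIsomorphisms where
  of_iso := by
    rintro M N e ⟨X, hX, ⟨e'⟩⟩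
    exact ⟨X, hX, ⟨e.symm ≪≫ e'⟩⟩

instance : (boundedD E).ContainsZero where
  exists_zero := ⟨(Qh E).obj ((HomotopyCategory.quotient _ _).obj 0),
    Functor.map_isZero _ (Functor.map_isZero _ (isZero_zero _)),
    0, IsBounded.zero, ⟨Iso.refl _⟩⟩

instance : (boundedD E).IsStableUnderShift ℤ where
  isStableUnderShiftBy a := ⟨fun M hM ↦ by
    obtain ⟨X, hX, ⟨e⟩⟩ := hM
    exact ⟨X⟦a⟧, hX.shift a, ⟨(shiftFunctor (D E) a).mapIso e ≪≫
      ((Qh E).commShiftIso a).symm.app _ ≪≫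
      (Qh E).mapIso (((HomotopyCategory.quotient _ _).commShiftIso a).symm.app X)⟩⟩⟩

instance : (boundedD E).IsTriangulatedClosed₃ where
  ext₃' T hT h₁ h₂ := by
    refine ObjectProperty.le_isoClosure _ _ ?_
    obtain ⟨Z, hZ, ⟨e₁ : _ ≅ (Qh E).obj ((HomotopyCategory.quotient _ _).obj Z)⟩⟩ := h₁
    obtain ⟨X, hX, ⟨e₂ : _ ≅ (Qh E).obj ((HomotopyCategory.quotient _ _).obj X)⟩⟩ := h₂
    obtain ⟨Y, s, g, hY, hs, fac⟩ := exists_bounded_leftFraction (E := E)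
      (X := (HomotopyCategory.quotient _ _).obj X) (Z := (HomotopyCategory.quotient _ _).obj Z)
      hX hZ (e₁.inv ≫ T.mor₁ ≫ e₂.hom)
    obtain ⟨C, p, q, hC⟩ := distinguished_cocone_triangle g
    obtain ⟨C', hC', ⟨e⟩⟩ := (boundedK E).isoClosure.ext_of_isTriangulatedClosed₃ _ hC
      (ObjectProperty.le_isoClosure _ _ hZ) hY
    obtain ⟨C', rfl⟩ := C'.quotient_obj_surjective
    refine ⟨C', hC', ⟨Triangle.π₃.mapIso (isoTriangleOfIso₁₂ T _ hT
      ((Qh E).map_distinguished _ hC) e₁ (e₂ ≪≫ @asIso _ _ _ _ _ hs) ?_) ≪≫ (Qh E).mapIso e⟩⟩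
    change T.mor₁ ≫ e₂.hom ≫ (Qh E).map s = e₁.hom ≫ (Qh E).map g
    rw [← fac]
    simp

/-- The objects isomorphic to bounded complexes form a triangulated subcategory of `D(E)`. -/
instance : (boundedD E).IsTriangulated where
  toIsTriangulatedClosed₂ := .of_isTriangulatedClosed₃

/-- The bounded derived category `Dᵇ(E)`. -/
abbrev Db : Type (max u v) := (boundedD E).FullSubcategory

end Bounded

section Projectives

variable {E : Type u} [Category.{v} E] [Preadditive E] [HasZeroObject E]
  [HasBinaryBiproducts E]

open ConflationCategory Opposite

/-- An object `P` of a conflation category is projective if the functor `Hom(P, -)` to abelian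
groups is exact, i.e. maps conflations to short exact sequences. -/
def IsProjectiveObj [ConflationCategory E] (P : E) : Prop :=
  ∀ S : ShortComplex E, conflation S → (S.map (preadditiveCoyoneda.obj (op P))).ShortExact

variable (E) in
/-- There are enough projectives if each object is the target of a deflation from a projective
object. -/
def HasEnoughProjectives [ConflationCategory E] : Prop :=
  ∀ M : E, ∃ (P : E) (p : P ⟶ M), IsProjectiveObj P ∧ IsDeflation p

lemma isProjectiveObj_iff [ConflationCategory E] (P : E) :
    IsProjectiveObj P ↔ ∀ {B C : E} (g : B ⟶ C) (_ : IsDeflation g) (f : P ⟶ C),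
      ∃ l : P ⟶ B, l ≫ g = f := by
  constructor
  · rintro h B C g ⟨A, i, w, hg⟩ f
    have := (h _ hg).epi_g
    exact (AddCommGrpCat.epi_iff_surjective _).1 this f
  · intro h S hS
    have hm := conflation_mono hS
    refine ShortComplex.ShortExact.mk' ?_ ?_ ?_
    · rw [ShortComplex.ab_exact_iff]
      intro (x : P ⟶ S.X₂) (hx : x ≫ S.g = 0)
      exact conflation_lift hS x hx
    · rw [AddCommGrpCat.mono_iff_injective]
      intro (a : P ⟶ S.X₁) (b : P ⟶ S.X₁) (hab : a ≫ S.f = b ≫ S.f)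
      exact (cancel_mono S.f).1 hab
    · rw [AddCommGrpCat.epi_iff_surjective]
      exact fun f ↦ h S.g ⟨_, _, _, hS⟩ f

lemma isProjectiveObj_of_isZero [ConflationCategory E] {P : E} (h : IsZero P) :
    IsProjectiveObj P := by
  rw [isProjectiveObj_iff]
  exact fun g _ f ↦ ⟨0, h.eq_of_src _ _⟩

lemma isProjectiveObj_mappingCone [ConflationCategory E] {X Y : CochainComplex E ℤ}
    (hX : ∀ n, IsProjectiveObj (X.X n)) (hY : ∀ n, IsProjectiveObj (Y.X n)) (φ : X ⟶ Y) (n : ℤ) :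
    IsProjectiveObj ((CochainComplex.mappingCone φ).X n) := by
  rw [isProjectiveObj_iff]
  intro B C g hg f
  obtain ⟨l₁, h₁⟩ := (isProjectiveObj_iff _).1 (hX (n + 1)) g hg
    ((CochainComplex.mappingCone.inl φ).v (n + 1) n (by lia) ≫ f)
  obtain ⟨l₂, h₂⟩ := (isProjectiveObj_iff _).1 (hY n) g hg
    ((CochainComplex.mappingCone.inr φ).f n ≫ f)
  refine ⟨(CochainComplex.mappingCone.fst φ).1.v n (n + 1) rfl ≫ l₁ +
    (CochainComplex.mappingCone.snd φ).v n n (add_zero n) ≫ l₂, ?_⟩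
  rw [CochainComplex.mappingCone.ext_from_iff _ (n + 1) n rfl]
  constructor
  · simp [h₁]
  · simp [h₂]

variable (E) [RightExactCategory E]

/-- The objects of `K^{-,b}(Proj E)`, as a full subcategory of `K(E)`: the complexes `X` with
projective terms such that `X.X n` is zero for `n ≫ 0` and which are quasi-isomorphic
(i.e. isomorphic in `D(E)`) to a bounded complex. -/
def kabProj : ObjectProperty (K E) := fun X ↦
  IsRightBounded X.as ∧ (∀ n, IsProjectiveObj (X.as.X n)) ∧ boundedD E ((Qh E).obj X)

instance : (kabProj E).IsStableUnderShift ℤ where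
  isStableUnderShiftBy a := ⟨fun X hX ↦ by
    obtain ⟨X, rfl⟩ := X.quotient_obj_surjective
    rw [ObjectProperty.prop_shift_iff, HomotopyCategory.shift_quotient_obj]
    refine ⟨IsRightBounded.shift (X := X) hX.1 a, fun n ↦ hX.2.1 (n + a), ?_⟩
    exact (boundedD E).prop_of_iso
      (((Qh E).commShiftIso a).symm.app _ ≪≫
        (Qh E).mapIso (((HomotopyCategory.quotient _ _).commShiftIso a).symm.app X))
      ((boundedD E).le_shift a _ hX.2.2)⟩

instance : (kabProj E).ContainsZero where
  exists_zero := ⟨(HomotopyCategory.quotient _ _).obj 0, Functor.map_isZero _ (isZero_zero _),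
    IsBounded.zero.2, fun n ↦ isProjectiveObj_of_isZero
      ((HomologicalComplex.eval E _ n).map_isZero (isZero_zero _)),
    0, IsBounded.zero, ⟨Iso.refl _⟩⟩

instance : (kabProj E).IsTriangulatedClosed₃ where
  ext₃' T hT h₁ h₂ := by
    obtain ⟨f : T.obj₁.as ⟶ T.obj₂.as, hf⟩ :=
      (HomotopyCategory.quotient _ _).map_surjective T.mor₁
    have hT' := HomotopyCategory.mappingCone_triangleh_distinguished f
    exact ⟨(HomotopyCategory.quotient _ _).obj (CochainComplex.mappingCone f),
      ⟨IsRightBounded.mappingCone h₁.1 h₂.1 f, isProjectiveObj_mappingCone h₁.2.1 h₂.2.1 f,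
        (boundedD E).ext_of_isTriangulatedClosed₃ _ ((Qh E).map_distinguished _ hT')
          h₁.2.2 h₂.2.2⟩,
      ⟨Triangle.π₃.mapIso (isoTriangleOfIso₁₂ T _ hT hT'
        (Iso.refl _) (Iso.refl _)
        (((Category.comp_id _).trans hf.symm).trans (Category.id_comp _).symm))⟩⟩

instance : (kabProj E).IsTriangulated where
  toIsTriangulatedClosed₂ := .of_isTriangulatedClosed₃

/-- The triangulated category `K^{-,b}(Proj E)`. -/
abbrev KabProj : Type (max u v) := (kabProj E).FullSubcategory

/-- The natural functor `K^{-,b}(Proj E) ⥤ Dᵇ(E)`: the restriction of the localization functor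
`K(E) ⥤ D(E)`. -/
def kabProjToDb : KabProj E ⥤ Db E :=
  (boundedD E).lift ((kabProj E).ι ⋙ Qh E) (fun X ↦ X.property.2.2)

instance : (kabProjToDb E).CommShift ℤ := by
  dsimp only [kabProjToDb]
  infer_instance

end Projectives

end

end OneSidedExact

open OneSidedExact

/-! The first two statements rest on an orthogonality in `K(E)`: a complex in degrees `≤ 0` has only
the zero map, up to homotopy, to an acyclic complex in degrees `≥ -1`. If `W` is such an acyclic
complex, then `W⁻¹` is identified with the kernel of `d⁰`, so the degree `0` component of a map
lifts to `W⁻¹`, and this lift is the whole homotopy (`IsAcyclic.quotient_map_eq_zero`). An acyclic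
complex mapping to a complex bounded below can be replaced by an acyclic one with the same lower
bound. Hence a fraction from a complex in degrees `≤ 0` to one in degrees `≥ 0` can be reduced to an
honest morphism of `K(E)`, and uniquely so (`Qh_map_bijective`). For stalk complexes, and for
positive shifts of them in the source, the morphisms in `K(E)` can be read off degreewise.

For a degreewise conflation `(f, g)`, the cone of `f` maps canonically to the third complex, and the
claim is that this map becomes invertible in `D(E)`. Its cone is shown to be acyclic by writing down
its cycle objects as pullbacks of the deflations `gⁿ`
(`AxiomR0Star.isAcyclic_mappingCone_coneDesc`). Axiom (R0*) makes split projections deflations, and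
hence makes a deflation stay one when a further summand is added to its source.

For the equivalence, right bounded complexes of projectives have no nonzero maps in `K(E)` to
acyclic complexes, by constructing a contraction by descending induction on the degree. The functor
is therefore fully faithful. Its essential image in `D(E)` is a triangulated subcategory. It
contains the stalk complexes, because brutally truncating an acyclic augmented resolution `⋯ → P₁ →
P₀ → M → 0` gives a triangle that compares the resolution with `M`. Brutal truncation triangles then
yield all bounded complexes by induction on their length. -/

namespace OneSidedExact

noncomputable section

/-! ### Null-homotopies from families indexed by single degrees -/

section NullHomotopic

variable {E : Type u} [Category.{v} E] [Preadditive E]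

/-- A morphism of cochain complexes that admits a contracting family of morphisms is zero in the
homotopy category. -/
lemma quotient_map_eq_zero {X Y : CochainComplex E ℤ} (f : X ⟶ Y)
    (h : ∀ n : ℤ, X.X (n + 1) ⟶ Y.X n)
    (hf : ∀ n : ℤ, f.f (n + 1) = X.d (n + 1) (n + 1 + 1) ≫ h (n + 1) + h n ≫ Y.d n (n + 1)) :
    (HomotopyCategory.quotient E (ComplexShape.up ℤ)).map f = 0 := by
  rw [← Functor.map_zero]
  refine HomotopyCategory.eq_of_homotopy _ _
    { hom := fun i j ↦ if hij : j + 1 = i then (X.XIsoOfEq hij).inv ≫ h j else 0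
      zero := fun i j hij ↦ dif_neg hij
      comm := fun i ↦ ?_ }
  obtain ⟨n, rfl⟩ : ∃ n, i = n + 1 := ⟨i - 1, by lia⟩
  rw [dNext_eq _ (show (ComplexShape.up ℤ).Rel (n + 1) (n + 1 + 1) from rfl),
    prevD_eq _ (show (ComplexShape.up ℤ).Rel n (n + 1) from rfl), hf n]
  simp [HomologicalComplex.XIsoOfEq]

end NullHomotopic

/-! ### Morphisms in the derived category between stalk complexes -/

section Stalk

variable {E : Type u} [Category.{v} E] [Preadditive E] [HasZeroObject E]
  [HasBinaryBiproducts E] [RightExactCategory E]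

open ConflationCategory RightExactCategory

/-- The cycles in the lowest degree are an epimorphic image of the zero object below, hence zero, so
the conflation there is `0 → W → Z`. It follows that the lowest differential is an isomorphism
followed by an inflation, in particular a monomorphism. -/
lemma Splicing.isIso_p {W : CochainComplex E ℤ} (s : Splicing W) (n : ℤ)
    [W.IsStrictlyGE (n + 1)] : IsIso (s.p (n + 1)) := by
  have h₀ : IsZero (W.X n) := W.isZero_of_isStrictlyGE (n + 1) n
  have := conflation_epi (s.conf n)
  have h₁ : IsZero (s.Z (n + 1)) := by
    rw [IsZero.iff_id_eq_zero, ← cancel_epi (s.p n)]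
    exact h₀.eq_of_src _ _
  obtain ⟨r, hr⟩ := conflation_desc (s.conf (n + 1)) (𝟙 _) (h₁.eq_of_src _ _)
  have := conflation_epi (s.conf (n + 1))
  dsimp at r hr this
  exact ⟨r, hr, by rw [← cancel_epi (s.p (n + 1)), reassoc_of% hr, Category.comp_id]⟩

/-- Up to homotopy, the only morphism from a complex in degrees `≤ 0` to an acyclic complex in
degrees `≥ -1` is zero. -/
lemma IsAcyclic.quotient_map_eq_zero {X W : CochainComplex E ℤ} (hW : IsAcyclic W)
    [X.IsStrictlyLE 0] [W.IsStrictlyGE (-1)] (f : X ⟶ W) :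
    (HomotopyCategory.quotient E (ComplexShape.up ℤ)).map f = 0 := by
  obtain ⟨s⟩ := hW.splicing
  have : W.IsStrictlyGE (-2 + 1) := by assumption
  have hp : IsIso (s.p (-1)) := s.isIso_p (-2)
  have hi (n : ℤ) : Mono (s.i n) := conflation_mono (s.conf n)
  have hd : s.p (-1) ≫ s.i 0 = W.d (-1) 0 := s.fac (-1)
  have hmono : Mono (W.d (-1) 0) := by rw [← hd]; exact mono_comp _ _
  have hX (n : ℤ) (hn : 0 < n) : IsZero (X.X n) := X.isZero_of_isStrictlyLE 0 n
  -- Since `X¹ = 0`, the component `f⁰` takes values in the cycles `Z⁰`, which are isomorphic to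
  -- `W⁻¹`.
  obtain ⟨z, hz⟩ : ∃ z, z ≫ s.i 0 = f.f 0 := conflation_lift (s.conf 0) (f.f 0) (by
    have := hi 1
    change f.f 0 ≫ s.p 0 = 0
    rw [← cancel_mono (s.i 1), Category.assoc, show s.p 0 ≫ s.i 1 = W.d 0 1 from s.fac 0,
      f.comm, (hX 1 (by lia)).eq_of_src (f.f 1) 0, comp_zero, zero_comp])
  obtain ⟨z', hz'⟩ : ∃ z' : X.X 0 ⟶ W.X (-1), z' ≫ W.d (-1) 0 = f.f 0 :=
    ⟨z ≫ inv (s.p (-1)), by rw [← hd, ← hz]; exact (by simp : (z ≫ inv (s.p (-1))) ≫ s.p (-1) ≫ s.i 0 = z ≫ s.i 0)⟩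
  -- The bounds on `X` and `W` leave room for a single component of the homotopy, `X⁰ → W⁻¹`,
  -- indexed by `n = -1`.
  let h : ∀ n : ℤ, X.X (n + 1) ⟶ W.X n
    | Int.ofNat _ => 0
    | Int.negSucc 0 => z'
    | Int.negSucc (k + 1) => 0
  refine OneSidedExact.quotient_map_eq_zero f h ?_
  intro n
  match n with
  | Int.ofNat k => exact (hX _ (by lia)).eq_of_src _ _
  | Int.negSucc 0 =>
    change f.f 0 = X.d 0 1 ≫ (0 : X.X 1 ⟶ W.X 0) + (z' ≫ W.d (-1) 0 : X.X 0 ⟶ W.X 0)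
    rw [hz', comp_zero, zero_add]
  | Int.negSucc 1 =>
    change f.f (-1) = X.d (-1) 0 ≫ z' + (0 : X.X (-1) ⟶ W.X (-2)) ≫ W.d (-2) (-1)
    -- In degree `-1` the identity is tested after the monomorphism `d⁻¹`, where it follows from
    -- degree `0`.
    rw [← cancel_mono (W.d (-1) 0), zero_comp, add_zero, Category.assoc, hz', f.comm]
  | Int.negSucc (k + 2) => exact (W.isZero_of_isStrictlyGE (-1) _ (by lia)).eq_of_tgt _ _

/-- A morphism from an acyclic complex to a complex in degrees `≥ n` factors through an acyclic
complex in degrees `≥ n`. -/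
lemma exists_fac_isStrictlyGE {X Y : K E} (hX : acyclicK E X) (n : ℤ)
    [CochainComplex.IsStrictlyGE Y.as n] (f : X ⟶ Y) :
    ∃ (W : CochainComplex E ℤ) (_ : W.IsStrictlyGE n)
      (a : X ⟶ (HomotopyCategory.quotient _ _).obj W)
      (b : (HomotopyCategory.quotient _ _).obj W ⟶ Y), IsAcyclic W ∧ a ≫ b = f := by
  obtain ⟨X, rfl⟩ := X.quotient_obj_surjective
  obtain ⟨Y, rfl⟩ := Y.quotient_obj_surjective
  obtain ⟨f, rfl⟩ := (HomotopyCategory.quotient _ _).map_surjective f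
  have : CochainComplex.IsStrictlyGE Y n := by assumption
  have : CochainComplex.IsStrictlyGE (Y⟦n⟧) 0 :=
    CochainComplex.isStrictlyGE_shift Y n n 0 (by lia)
  obtain ⟨W, hW, a, b, hW', fac⟩ := (IsAcyclic.shift (X := X) hX n).exists_fac_ge (f⟦n⟧')
  refine ⟨W⟦-n⟧, W.isStrictlyGE_shift 0 (-n) n (by lia), (HomotopyCategory.quotient _ _).map
    ((shiftFunctorCompIsoId _ n (-n) (add_neg_cancel n)).inv.app X ≫ a⟦-n⟧'),
    (HomotopyCategory.quotient _ _).map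
    (b⟦-n⟧' ≫ (shiftFunctorCompIsoId _ n (-n) (add_neg_cancel n)).hom.app Y), hW'.shift (-n), ?_⟩
  rw [← Functor.map_comp, Category.assoc, ← Functor.map_comp_assoc, fac, shift_shift_neg']
  simp

/-- Morphisms from a complex in degrees `≤ 0` to a complex in degrees `≥ 0` are the same in `K(E)`
and in `D(E)`. -/
lemma Qh_map_bijective (X Y : CochainComplex E ℤ) [X.IsStrictlyLE 0] [Y.IsStrictlyGE 0] :
    Function.Bijective ((Qh E).map :
      ((HomotopyCategory.quotient _ _).obj X ⟶ (HomotopyCategory.quotient _ _).obj Y) → _) := by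
  have hzero {W : CochainComplex E ℤ} (hW : IsAcyclic W) (_ : W.IsStrictlyGE (-1))
      (f : (HomotopyCategory.quotient _ _).obj X ⟶ (HomotopyCategory.quotient _ _).obj W) :
      f = 0 := by
    obtain ⟨f, rfl⟩ := (HomotopyCategory.quotient _ _).map_surjective f
    exact hW.quotient_map_eq_zero f
  constructor
  · intro f₁ f₂ hf
    rw [MorphismProperty.map_eq_iff_postcomp (Qh E) (acyclicK E).trW] at hf
    obtain ⟨Z, s, hs, hf⟩ := hf
    rw [ObjectProperty.trW_iff'] at hs
    obtain ⟨A, a, b, hT, hA⟩ := hs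
    -- The difference factors through an acyclic `A`, which may be unbounded. Orthogonality applies
    -- only after `A ⟶ Y` is factored through an acyclic complex in degrees `≥ 0`.
    obtain ⟨g : _ ⟶ A, hg : f₁ - f₂ = g ≫ a⟩ := Triangle.coyoneda_exact₂ _ hT (f₁ - f₂) (by
      change (f₁ - f₂) ≫ s = 0
      rw [Preadditive.sub_comp, hf, sub_self])
    have : CochainComplex.IsStrictlyGE
      ((HomotopyCategory.quotient E (ComplexShape.up ℤ)).obj Y).as 0 := by assumption
    obtain ⟨W, hW, c, d, hW', fac⟩ := exists_fac_isStrictlyGE hA 0 a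
    rw [← sub_eq_zero, hg, ← fac, ← Category.assoc,
      hzero hW' (W.isStrictlyGE_of_ge (-1) 0 (by lia)) (g ≫ c), zero_comp]
  · intro w
    obtain ⟨φ, hφ⟩ := Localization.exists_leftFraction (Qh E) (acyclicK E).trW w
    obtain ⟨A, π, δ, hT, hA⟩ := φ.hs
    -- The connecting morphism of the denominator ends in `Y⟦1⟧`, which reaches down to degree `-1`.
    -- This is why orthogonality is needed for that bound and not only for `0`.
    have : CochainComplex.IsStrictlyGE
        (((HomotopyCategory.quotient E (ComplexShape.up ℤ)).obj Y)⟦(1 : ℤ)⟧).as (-1) := by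
      rw [HomotopyCategory.shift_quotient_obj]
      exact CochainComplex.isStrictlyGE_shift Y 0 1 (-1) (by lia)
    obtain ⟨W, hW, α, β, hW', fac⟩ := exists_fac_isStrictlyGE hA (-1) δ
    -- The fraction is expanded along `y` to one with denominator `s`, whose cone `W` is bounded
    -- below.
    obtain ⟨Z, s, π', hT'⟩ := distinguished_cocone_triangle₂ β
    obtain ⟨y : φ.Y' ⟶ Z, hy₁ : φ.s ≫ y = 𝟙 _ ≫ s, hy₂ : π ≫ α = y ≫ π'⟩ :=
      complete_distinguished_triangle_morphism₂ _ _ hT hT' (𝟙 _) α (by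
        change δ ≫ (𝟙 _)⟦(1 : ℤ)⟧' = α ≫ β
        rw [CategoryTheory.Functor.map_id, Category.comp_id, fac])
    rw [Category.id_comp] at hy₁
    -- The new numerator dies in `W` by orthogonality, so it factors through the denominator and the
    -- fraction is the image of `x`.
    obtain ⟨x : _ ⟶ (HomotopyCategory.quotient _ _).obj Y, hx : φ.f ≫ y = x ≫ s⟩ :=
      Triangle.coyoneda_exact₂ _ hT' (φ.f ≫ y) (hzero hW' hW _)
    have hs : IsIso ((Qh E).map s) :=
      Localization.inverts (Qh E) (acyclicK E).trW _ ⟨_, _, _, hT', hW'⟩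
    have hw : w ≫ (Qh E).map φ.s = (Qh E).map φ.f := by
      rw [hφ]; simp
    refine ⟨x, ?_⟩
    rw [← cancel_mono ((Qh E).map s), ← Functor.map_comp, ← hx, ← hy₁, Functor.map_comp,
      Functor.map_comp, reassoc_of% hw]

variable (E) in
/-- The functor from `E` to `K(E)` given by stalk complexes is fully faithful. -/
lemma single_quotient_map_bijective (X Y : E) :
    Function.Bijective (fun f : X ⟶ Y ↦ (HomotopyCategory.quotient E (ComplexShape.up ℤ)).map
      ((HomologicalComplex.single E (ComplexShape.up ℤ) 0).map f)) := by
  constructor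
  · intro f g hfg
    have h := HomotopyCategory.homotopyOfEq _ _ hfg
    -- All differentials of stalk complexes vanish, so the homotopy terms drop out in degree `0`.
    have h₀ := h.comm 0
    rw [dNext_eq _ (show (ComplexShape.up ℤ).Rel 0 1 from rfl),
      prevD_eq _ (show (ComplexShape.up ℤ).Rel (-1) 0 from rfl)] at h₀
    exact (HomologicalComplex.single E (ComplexShape.up ℤ) 0).map_injective
      (HomologicalComplex.to_single_hom_ext (by simpa using h₀))
  · intro f
    obtain ⟨f, rfl⟩ := (HomotopyCategory.quotient _ _).map_surjective f
    obtain ⟨f, rfl⟩ := (HomologicalComplex.single E (ComplexShape.up ℤ) 0).map_surjective f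
    exact ⟨f, rfl⟩

-- A stalk complex lies both in degrees `≤ 0` and in degrees `≥ 0`, so the comparison of `K(E)` with
-- `D(E)` applies to every pair of stalks.
variable (E) in
lemma stalk_full_faithful : (stalk E).Full ∧ (stalk E).Faithful := by
  have h (X Y : E) : Function.Bijective ((stalk E).map : (X ⟶ Y) → _) :=
    (Qh_map_bijective ((HomologicalComplex.single E (ComplexShape.up ℤ) 0).obj X)
      ((HomologicalComplex.single E (ComplexShape.up ℤ) 0).obj Y)).comp
      (single_quotient_map_bijective E X Y)
  exact ⟨⟨(h _ _).2⟩, ⟨fun hfg ↦ (h _ _).1 hfg⟩⟩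

/-- The source is concentrated in degree `-n < 0`, so the morphism comes from a chain map, and that
chain map is zero because the two complexes have disjoint supports. -/
lemma shift_stalk_hom_eq_zero (X Y : E) (n : ℤ) (hn : 0 < n)
    (f : ((stalk E).obj X)⟦n⟧ ⟶ (stalk E).obj Y) : f = 0 := by
  let S (M : E) : CochainComplex E ℤ := (HomologicalComplex.single E (ComplexShape.up ℤ) 0).obj M
  have : CochainComplex.IsStrictlyLE ((S X)⟦n⟧) (-n) :=
    CochainComplex.isStrictlyLE_shift _ 0 n (-n) (by lia)
  have : CochainComplex.IsStrictlyLE ((S X)⟦n⟧) 0 :=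
    CochainComplex.isStrictlyLE_of_le _ (-n) 0 (by lia)
  let e : (Qh E).obj ((HomotopyCategory.quotient _ _).obj ((S X)⟦n⟧)) ≅ ((stalk E).obj X)⟦n⟧ :=
    (Qh E).mapIso (((HomotopyCategory.quotient E (ComplexShape.up ℤ)).commShiftIso n).app (S X)) ≪≫
    ((Qh E).commShiftIso n).app _
  obtain ⟨g, hg⟩ := (Qh_map_bijective ((S X)⟦n⟧) (S Y)).2 (e.hom ≫ f)
  obtain ⟨g, rfl⟩ := (HomotopyCategory.quotient _ _).map_surjective g
  have hg₀ : g = 0 := by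
    refine HomologicalComplex.Hom.ext (funext fun i ↦ ?_)
    by_cases hi : i = 0
    · subst hi
      exact (CochainComplex.isZero_of_isStrictlyLE _ (-n) _ (by lia)).eq_of_src _ _
    · exact (HomologicalComplex.isZero_single_obj_X _ _ _ _ hi).eq_of_tgt _ _
  rw [← cancel_epi e.hom]
  refine hg.symm.trans ?_
  rw [hg₀, Functor.map_zero, Functor.map_zero, comp_zero]
  rfl

end Stalk

/-! ### Triangles from degreewise conflations under (R0*) -/

section DegreewiseConflation

variable {E : Type u} [Category.{v} E] [Preadditive E] [HasZeroObject E]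
  [HasBinaryBiproducts E] [RightExactCategory E]

open ConflationCategory RightExactCategory CochainComplex HomComplex

/-- The projection is the pullback of the deflation `B ⟶ 0` along `A ⟶ 0`. -/
lemma AxiomR0Star.isDeflation_biprod_fst (h₀ : AxiomR0Star E) (A B : E) :
    IsDeflation (biprod.fst : A ⊞ B ⟶ A) :=
  isDeflation_of_isPullback (a := biprod.snd) (f := 0) ⟨⟨by simp⟩, ⟨PullbackCone.IsLimit.mk _
    (fun c ↦ biprod.lift c.snd c.fst) (fun c ↦ by simp) (fun c ↦ by simp)
    (fun c m hm₁ hm₂ ↦ by apply biprod.hom_ext <;> simp [hm₁, hm₂])⟩⟩ (h₀ B)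

/-- Factor the map as `q ⊕ 1` followed by `(1, r)`. The first is a pullback of `q`, and the second
becomes the projection `C ⊞ B ⟶ C` after a shear automorphism of `C ⊞ B`. -/
lemma AxiomR0Star.isDeflation_biprod_desc (h₀ : AxiomR0Star E) {A B C : E} {q : A ⟶ C}
    (hq : IsDeflation q) (r : B ⟶ C) : IsDeflation (biprod.desc q r) := by
  have h₁ : IsDeflation (biprod.map q (𝟙 B)) := by
    refine isDeflation_of_isPullback (a := biprod.fst) (f := biprod.fst) (g := q)
      ⟨⟨by simp⟩, ⟨PullbackCone.IsLimit.mk _ (fun c ↦ biprod.lift c.fst (c.snd ≫ biprod.snd))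
        (fun c ↦ by simp) (fun c ↦ ?_) (fun c m hm₁ hm₂ ↦ ?_)⟩⟩ hq
    · apply biprod.hom_ext <;> simp [c.condition]
    · apply biprod.hom_ext
      · simpa using hm₁
      · simp [← hm₂]
  have h₂ : IsDeflation (biprod.desc (𝟙 C) r) := by
    refine isDeflation_of_arrow_iso (f := biprod.fst)
      { hom := biprod.lift (biprod.fst - biprod.snd ≫ r) biprod.snd
        inv := biprod.lift (biprod.fst + biprod.snd ≫ r) biprod.snd
        hom_inv_id := ?_
        inv_hom_id := ?_ } (Iso.refl _) ?_ (h₀.isDeflation_biprod_fst C B)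
    · apply biprod.hom_ext <;> simp
    · apply biprod.hom_ext <;> simp
    · simp [biprod.lift_desc]
  have : biprod.desc q r = biprod.map q (𝟙 B) ≫ biprod.desc (𝟙 C) r := by
    apply biprod.hom_ext' <;> simp
  rw [this]
  exact isDeflation_comp _ _ h₁ h₂

/-- The canonical morphism from the mapping cone of `S.f` to `S.X₃`. -/
def coneDesc (S : ShortComplex (CochainComplex E ℤ)) : mappingCone S.f ⟶ S.X₃ :=
  mappingCone.desc S.f 0 S.g (by simp)

lemma inr_coneDesc (S : ShortComplex (CochainComplex E ℤ)) :
    mappingCone.inr S.f ≫ coneDesc S = S.g := by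
  simp [coneDesc]

/-- The terms and the differential of the mapping cone of `coneDesc S`. -/
lemma exists_iso_mappingCone_coneDesc (S : ShortComplex (CochainComplex E ℤ)) :
    ∃ e : ∀ n : ℤ, (mappingCone (coneDesc S)).X n ≅
        (S.X₁.X (n + 1 + 1) ⊞ S.X₂.X (n + 1)) ⊞ S.X₃.X n, ∀ n : ℤ,
      (mappingCone (coneDesc S)).d n (n + 1) ≫ (e (n + 1)).hom ≫ biprod.fst ≫ biprod.fst =
        (e n).hom ≫ biprod.fst ≫ biprod.fst ≫ S.X₁.d (n + 1 + 1) (n + 1 + 1 + 1) ∧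
      (mappingCone (coneDesc S)).d n (n + 1) ≫ (e (n + 1)).hom ≫ biprod.fst ≫ biprod.snd =
        (e n).hom ≫ biprod.fst ≫
          (- (biprod.fst ≫ S.f.f (n + 1 + 1)) - biprod.snd ≫ S.X₂.d (n + 1) (n + 1 + 1)) ∧
      (mappingCone (coneDesc S)).d n (n + 1) ≫ (e (n + 1)).hom ≫ biprod.snd =
        (e n).hom ≫ (biprod.fst ≫ biprod.snd ≫ S.g.f (n + 1) +
          biprod.snd ≫ S.X₃.d n (n + 1)) := by
  let e (n : ℤ) : (mappingCone (coneDesc S)).X n ≅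
      (S.X₁.X (n + 1 + 1) ⊞ S.X₂.X (n + 1)) ⊞ S.X₃.X n :=
    { hom := biprod.lift ((mappingCone.fst (coneDesc S)).1.v n (n + 1) rfl ≫
          biprod.lift ((mappingCone.fst S.f).1.v (n + 1) (n + 1 + 1) rfl)
            ((mappingCone.snd S.f).v (n + 1) (n + 1) (add_zero _)))
        ((mappingCone.snd (coneDesc S)).v n n (add_zero n))
      inv := biprod.desc
        (biprod.desc ((mappingCone.inl S.f).v (n + 1 + 1) (n + 1) (by lia))
          ((mappingCone.inr S.f).f (n + 1)) ≫ (mappingCone.inl (coneDesc S)).v (n + 1) n (by lia))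
        ((mappingCone.inr (coneDesc S)).f n)
      hom_inv_id := by
        rw [mappingCone.ext_from_iff _ (n + 1) n rfl]
        refine ⟨?_, by simp⟩
        rw [← cancel_epi (𝟙 _), mappingCone.ext_from_iff _ (n + 1 + 1) (n + 1) rfl]
        simp
      inv_hom_id := by ext <;> simp }
  refine ⟨e, fun n ↦ ⟨?_, ?_, ?_⟩⟩
  · simp [e, mappingCone.d_fst_v_assoc _ n (n + 1) (n + 1 + 1) rfl rfl,
      mappingCone.d_fst_v _ (n + 1) (n + 1 + 1) (n + 1 + 1 + 1) rfl rfl]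
  · simp [e, mappingCone.d_fst_v_assoc _ n (n + 1) (n + 1 + 1) rfl rfl,
      mappingCone.d_snd_v _ (n + 1) (n + 1 + 1) rfl]
    abel
  · have : (coneDesc S).f (n + 1) =
        (mappingCone.snd S.f).v (n + 1) (n + 1) (add_zero _) ≫ S.g.f (n + 1) := by
      rw [mappingCone.ext_from_iff _ (n + 1 + 1) (n + 1) rfl]
      simp [coneDesc]
    simp [e, mappingCone.d_snd_v _ n (n + 1) rfl, this]

/-- If `S` is a degreewise conflation of complexes, then the comparison morphism from the mapping
cone of `S.f` to `S.X₃` has an acyclic mapping cone. -/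
lemma AxiomR0Star.isAcyclic_mappingCone_coneDesc (h₀ : AxiomR0Star E)
    (S : ShortComplex (CochainComplex E ℤ))
    (hS : ∀ n : ℤ, conflation (S.map (HomologicalComplex.eval E (ComplexShape.up ℤ) n))) :
    IsAcyclic (mappingCone (coneDesc S)) := by
  have hfg (n : ℤ) : S.f.f n ≫ S.g.f n = 0 := by
    rw [← HomologicalComplex.comp_f, S.zero, HomologicalComplex.zero_f]
  have hf (n : ℤ) : Mono (S.f.f n) := conflation_mono (hS n)
  have hg (n : ℤ) : IsDeflation (S.g.f n) := ⟨_, S.f.f n, hfg n, hS n⟩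
  have hl (n : ℤ) {A : E} (k : A ⟶ S.X₂.X n) (hk : k ≫ S.g.f n = 0) :
      ∃ l, l ≫ S.f.f n = k := conflation_lift (hS n) k hk
  -- In element notation the cone has differential `(x, y, z) ↦ (d x, -f x - d y, g y + d z)`. A
  -- cycle satisfies `g y = -d z` and `f x = -d y`, and `x` is determined by `y` because `f` is a
  -- monomorphism. The cycle object is therefore the pullback `P` of pairs `(y, z)`, and `ξ` below
  -- recovers `x`.
  have hP (n : ℤ) := exists_pullback (S.g.f (n + 1)) (- S.X₃.d n (n + 1)) (hg (n + 1))
  choose P a b sq hb using hP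
  have hab (n : ℤ) : a n ≫ S.g.f (n + 1) = - (b n ≫ S.X₃.d n (n + 1)) := by rw [(sq n).w]; simp
  have hξ (n : ℤ) : ∃ ξ : P n ⟶ S.X₁.X (n + 1 + 1),
      ξ ≫ S.f.f (n + 1 + 1) = - (a n ≫ S.X₂.d (n + 1) (n + 1 + 1)) := by
    refine hl _ _ ?_
    rw [Preadditive.neg_comp, Category.assoc, ← S.g.comm, reassoc_of% (hab n)]
    simp
  choose ξ hξ using hξ
  obtain ⟨e, he⟩ := exists_iso_mappingCone_coneDesc S
  -- From here on only the decomposition into three summands and the formulas for the differential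
  -- matter.
  generalize mappingCone (coneDesc S) = T at e he ⊢
  -- the three components of `T`
  let x (n : ℤ) : T.X n ⟶ S.X₁.X (n + 1 + 1) := (e n).hom ≫ biprod.fst ≫ biprod.fst
  let y (n : ℤ) : T.X n ⟶ S.X₂.X (n + 1) := (e n).hom ≫ biprod.fst ≫ biprod.snd
  let z (n : ℤ) : T.X n ⟶ S.X₃.X n := (e n).hom ≫ biprod.snd
  have ext {n : ℤ} {A : E} {k l : A ⟶ T.X n} (h₁ : k ≫ x n = l ≫ x n) (h₂ : k ≫ y n = l ≫ y n)
      (h₃ : k ≫ z n = l ≫ z n) : k = l := by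
    rw [← cancel_mono (e n).hom]
    apply biprod.hom_ext
    · apply biprod.hom_ext
      · simpa [x] using h₁
      · simpa [y] using h₂
    · simpa [z] using h₃
  have dx (n : ℤ) : T.d n (n + 1) ≫ x (n + 1) = x n ≫ S.X₁.d (n + 1 + 1) (n + 1 + 1 + 1) := by
    simpa [x] using (he n).1
  have dy (n : ℤ) : T.d n (n + 1) ≫ y (n + 1) =
      - (x n ≫ S.f.f (n + 1 + 1)) - y n ≫ S.X₂.d (n + 1) (n + 1 + 1) := by
    simpa [x, y] using (he n).2.1
  have dz (n : ℤ) : T.d n (n + 1) ≫ z (n + 1) =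
      y n ≫ S.g.f (n + 1) + z n ≫ S.X₃.d n (n + 1) := by
    simpa [y, z] using (he n).2.2
  let I (n : ℤ) : P n ⟶ T.X n := biprod.lift (biprod.lift (ξ n) (a n)) (b n) ≫ (e n).inv
  have Ix (n : ℤ) : I n ≫ x n = ξ n := by simp [I, x]
  have Iy (n : ℤ) : I n ≫ y n = a n := by simp [I, y]
  have Iz (n : ℤ) : I n ≫ z n = b n := by simp [I, z]
  have hImono (n : ℤ) : Mono (I n) := by
    refine Preadditive.mono_of_cancel_zero _ (fun {A} g hg ↦ (sq n).hom_ext ?_ ?_)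
    · rw [← Iy, reassoc_of% hg, zero_comp, zero_comp]
    · rw [← Iz, reassoc_of% hg, zero_comp, zero_comp]
  have hQ (n : ℤ) : ∃ q : T.X n ⟶ P (n + 1),
      q ≫ a (n + 1) = T.d n (n + 1) ≫ y (n + 1) ∧ q ≫ b (n + 1) = T.d n (n + 1) ≫ z (n + 1) := by
    refine ⟨(sq (n + 1)).lift _ _ ?_, (sq (n + 1)).lift_fst _ _ _, (sq (n + 1)).lift_snd _ _ _⟩
    rw [dy, dz]
    simp [hfg]
  choose q hqa hqb using hQ
  have hfac (n : ℤ) : q n ≫ I (n + 1) = T.d n (n + 1) := by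
    refine ext ?_ ?_ ?_
    · rw [Category.assoc, Ix, dx, ← cancel_mono (S.f.f _), Category.assoc, hξ,
        Preadditive.comp_neg, reassoc_of% (hqa n), reassoc_of% (dy n)]
      simp
    · rw [Category.assoc, Iy, hqa]
    · rw [Category.assoc, Iz, hqb]
  have hw (n : ℤ) : I n ≫ q n = 0 := by
    apply (sq (n + 1)).hom_ext
    · rw [Category.assoc, hqa, dy, Preadditive.comp_sub, Preadditive.comp_neg,
        reassoc_of% (Ix n), reassoc_of% (Iy n), hξ]
      simp
    · rw [Category.assoc, hqb, dz, Preadditive.comp_add, reassoc_of% (Iy n), reassoc_of% (Iz n),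
        hab]
      simp
  have hker (n : ℤ) {A : E} (k : A ⟶ T.X n) (hk : k ≫ q n = 0) : ∃ l : A ⟶ P n, l ≫ I n = k := by
    have h₁ : k ≫ T.d n (n + 1) = 0 := by rw [← hfac, reassoc_of% hk, zero_comp]
    have h₂ := h₁ =≫ y (n + 1)
    have h₃ := h₁ =≫ z (n + 1)
    rw [Category.assoc, dy, zero_comp, Preadditive.comp_sub, sub_eq_zero] at h₂
    rw [Category.assoc, dz, zero_comp, Preadditive.comp_add] at h₃
    have h₄ : (k ≫ y n) ≫ S.g.f (n + 1) = (k ≫ z n) ≫ (- S.X₃.d n (n + 1)) := by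
      rw [← sub_eq_zero]; simpa using h₃
    refine ⟨(sq n).lift _ _ h₄, ext ?_ ?_ ?_⟩
    · rw [Category.assoc, Ix, ← cancel_mono (S.f.f _), Category.assoc, hξ, Preadditive.comp_neg,
        (sq n).lift_fst_assoc, Category.assoc, ← h₂]
      simp
    · rw [Category.assoc, Iy, (sq n).lift_fst]
    · rw [Category.assoc, Iz, (sq n).lift_snd]
  have hdefl (n : ℤ) : IsDeflation (q n) := by
    -- Split `q` as `q₀` on the first two summands and `r` on the third. By
    -- `isDeflation_biprod_desc` it is enough that `q₀` is a deflation.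
    obtain ⟨q₀, hqa₀, hqb₀⟩ : ∃ q₀ : S.X₁.X (n + 1 + 1) ⊞ S.X₂.X (n + 1) ⟶ P (n + 1),
        q₀ ≫ a (n + 1) = - (biprod.fst ≫ S.f.f (n + 1 + 1)) -
          biprod.snd ≫ S.X₂.d (n + 1) (n + 1 + 1) ∧
        q₀ ≫ b (n + 1) = biprod.snd ≫ S.g.f (n + 1) := by
      refine ⟨(sq (n + 1)).lift _ _ ?_, (sq (n + 1)).lift_fst _ _ _, (sq (n + 1)).lift_snd _ _ _⟩
      simp [hfg]
    obtain ⟨r, hra, hrb⟩ : ∃ r : S.X₃.X n ⟶ P (n + 1),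
        r ≫ a (n + 1) = 0 ∧ r ≫ b (n + 1) = S.X₃.d n (n + 1) :=
      ⟨(sq (n + 1)).lift _ _ (by simp), (sq (n + 1)).lift_fst _ _ _, (sq (n + 1)).lift_snd _ _ _⟩
    have hq₀ : IsDeflation q₀ := by
      -- The map `q₀` is the pullback of `g` along `b`: given `y` and a cycle `(y', z')` with `g y =
      -- z'`, the element `-y' - d y` is killed by `g`, so it equals `f x` for a unique `x`.
      refine isDeflation_of_isPullback (a := biprod.snd) (f := b (n + 1)) ?_ (hg (n + 1))
      have H (c : PullbackCone (S.g.f (n + 1)) (b (n + 1))) : ∃ t, t ≫ S.f.f (n + 1 + 1) =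
          - (c.snd ≫ a (n + 1)) - c.fst ≫ S.X₂.d (n + 1) (n + 1 + 1) := by
        refine hl _ _ ?_
        rw [Preadditive.sub_comp, Preadditive.neg_comp, Category.assoc, Category.assoc, hab,
          ← S.g.comm, c.condition_assoc]
        simp
      refine ⟨⟨by rw [hqb₀]⟩, ⟨PullbackCone.IsLimit.mk _
        (fun c ↦ biprod.lift (H c).choose c.fst) (fun c ↦ by simp) (fun c ↦ ?_)
        (fun c m h₁ h₂ ↦ ?_)⟩⟩
      · apply (sq (n + 1)).hom_ext
        · rw [Category.assoc, hqa₀, Preadditive.comp_sub, Preadditive.comp_neg,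
            biprod.lift_fst_assoc, biprod.lift_snd_assoc, (H c).choose_spec]
          abel
        · rw [Category.assoc, hqb₀, biprod.lift_snd_assoc, c.condition]
      · apply biprod.hom_ext
        · rw [biprod.lift_fst, ← cancel_mono (S.f.f _), (H c).choose_spec, ← h₁, ← h₂]
          simp [hqa₀]
        · simpa using h₁
    refine isDeflation_of_arrow_iso (f := biprod.desc q₀ r) (e n).symm (Iso.refl _) ?_
      (h₀.isDeflation_biprod_desc hq₀ r)
    rw [Iso.refl_hom, Category.comp_id, ← cancel_epi (e n).hom, Iso.symm_hom,
      Iso.hom_inv_id_assoc]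
    apply (sq (n + 1)).hom_ext
    · rw [hqa, dy]
      simp [x, y, biprod.desc_eq, hqa₀, hra]
    · rw [hqb, dz]
      simp [y, z, biprod.desc_eq, hqb₀, hrb]
  refine Splicing.isAcyclic ⟨P, I, q, hw, fun n ↦ ?_, hfac⟩
  have : Mono (ShortComplex.mk (I n) (q n) (hw n)).f := hImono n
  exact conflation_of_isDeflation _ (hdefl n) (fun k hk ↦ hker n k hk)

/-- Degreewise conflations of complexes give distinguished triangles in the derived category. -/
lemma AxiomR0Star.exists_distTriang (h₀ : AxiomR0Star E)
    (S : ShortComplex (CochainComplex E ℤ))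
    (hS : ∀ n : ℤ, conflation (S.map (HomologicalComplex.eval E (ComplexShape.up ℤ) n))) :
    ∃ δ : (Q E).obj S.X₃ ⟶ ((Q E).obj S.X₁)⟦(1 : ℤ)⟧,
      Triangle.mk ((Q E).map S.f) ((Q E).map S.g) δ ∈ distTriang (D E) := by
  -- The required triangle is the cone triangle of `S.f` with its third vertex transported along
  -- this isomorphism.
  have hiso : IsIso ((Q E).map (coneDesc S)) :=
    Localization.inverts (Qh E) (acyclicK E).trW _
      ⟨_, _, _, HomotopyCategory.mappingCone_triangleh_distinguished
        (coneDesc S), h₀.isAcyclic_mappingCone_coneDesc S hS⟩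
  have hT := (Qh E).map_distinguished _
    (HomotopyCategory.mappingCone_triangleh_distinguished S.f)
  refine ⟨inv ((Q E).map (coneDesc S)) ≫
    ((Qh E).mapTriangle.obj (mappingCone.triangleh S.f)).mor₃,
    isomorphic_distinguished _ hT _ (Iso.symm (Triangle.isoMk _ _ (Iso.refl _) (Iso.refl _)
      (@asIso _ _ _ _ _ hiso) ?_ ?_ ?_))⟩
  · exact (Category.comp_id _).trans (Category.id_comp _).symm
  · refine Eq.trans ?_ (Category.id_comp _).symm
    change (Q E).map (mappingCone.inr S.f) ≫ (Q E).map (coneDesc S) = _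
    rw [← Functor.map_comp, inr_coneDesc]
    rfl
  · refine (Eq.trans ?_ (Category.comp_id _)).trans (IsIso.hom_inv_id_assoc
      ((Q E).map (coneDesc S)) ((Qh E).mapTriangle.obj (mappingCone.triangleh S.f)).mor₃).symm
    exact congr_arg (_ ≫ ·) (CategoryTheory.Functor.map_id _ _)

/-- Conflations give distinguished triangles of stalk complexes in the derived category. -/
lemma AxiomR0Star.exists_distTriang_stalk (h₀ : AxiomR0Star E) (S : ShortComplex E)
    (hS : conflation S) :
    ∃ δ : (stalk E).obj S.X₃ ⟶ ((stalk E).obj S.X₁)⟦(1 : ℤ)⟧,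
      Triangle.mk ((stalk E).map S.f) ((stalk E).map S.g) δ ∈ distTriang (D E) := by
  refine h₀.exists_distTriang (S.map (HomologicalComplex.single E (ComplexShape.up ℤ) 0))
    (fun n ↦ ?_)
  by_cases hn : n = 0
  · subst hn
    let e (X : E) := (HomologicalComplex.singleObjXSelf (ComplexShape.up ℤ) 0 X).symm
    have he {X Y : E} (f : X ⟶ Y) : (e X).hom ≫
        ((HomologicalComplex.single E (ComplexShape.up ℤ) 0).map f).f 0 = f ≫ (e Y).hom := by
      simp [e, HomologicalComplex.single_map_f_self]
    exact conflation_of_iso (ShortComplex.isoMk (e S.X₁) (e S.X₂) (e S.X₃) (he S.f) (he S.g)) hS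
  · have h (X : E) : IsZero (((HomologicalComplex.single E (ComplexShape.up ℤ) 0).obj X).X n) :=
      HomologicalComplex.isZero_single_obj_X _ _ _ _ hn
    have : IsIso ((S.map (HomologicalComplex.single E (ComplexShape.up ℤ) 0)).map
      (HomologicalComplex.eval E (ComplexShape.up ℤ) n)).g := (h _).isIso (h _) _
    exact conflation_of_isIso _ (h _)

end DegreewiseConflation

/-! ### Full faithfulness on right bounded complexes of projectives -/

section KProjective

variable {E : Type u} [Category.{v} E] [Preadditive E] [HasZeroObject E]
  [HasBinaryBiproducts E] [RightExactCategory E]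

open ConflationCategory RightExactCategory

/-- Up to homotopy, the only morphism from a right bounded complex with projective terms to an
acyclic complex is zero. -/
lemma IsAcyclic.quotient_map_eq_zero_of_projective {X W : CochainComplex E ℤ} (hW : IsAcyclic W)
    (hX : IsRightBounded X) (hX' : ∀ n, IsProjectiveObj (X.X n)) (f : X ⟶ W) :
    (HomotopyCategory.quotient E (ComplexShape.up ℤ)).map f = 0 := by
  obtain ⟨s⟩ := hW.splicing
  obtain ⟨b, _⟩ := hX
  have hzero (n : ℤ) (hn : b < n) : IsZero (X.X n) := X.isZero_of_isStrictlyLE b n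
  -- The contraction is built downwards in the degree. The condition carried along is exactly what
  -- makes `f - d h` in degree `n` land in the cycles of `W`, so that the next component can be
  -- chosen.
  let H (n : ℤ) : Type v := { h : X.X (n + 1) ⟶ W.X n //
    X.d n (n + 1) ≫ h ≫ W.d n (n + 1) = X.d n (n + 1) ≫ f.f (n + 1) }
  have step (k m : ℤ) (hm : k = m + 1) (h : H k) : ∃ h' : H m,
      f.f k = X.d k (k + 1) ≫ h.1 + (X.XIsoOfEq hm).hom ≫ h'.1 ≫ W.d m k := by
    subst hm
    have := conflation_mono (s.conf (m + 1 + 1))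
    dsimp at this
    obtain ⟨z, hz⟩ := conflation_lift (s.conf (m + 1)) (f.f (m + 1) - X.d _ _ ≫ h.1) (by
      dsimp
      rw [← cancel_mono (s.i (m + 1 + 1)), Category.assoc, s.fac, Preadditive.sub_comp, f.comm,
        Category.assoc, h.2, sub_self, zero_comp])
    -- Projectivity lifts the map to cycles through the deflation `W.X m ⟶ Z (m + 1)`.
    obtain ⟨l, hl⟩ := (isProjectiveObj_iff _).1 (hX' (m + 1)) (s.p m) ⟨_, _, _, s.conf m⟩ z
    dsimp at hz
    have hl' : l ≫ W.d m (m + 1) = f.f (m + 1) - X.d _ _ ≫ h.1 := by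
      rw [← s.fac, reassoc_of% hl, hz]
    exact ⟨⟨l, by simp [hl']⟩, by simp [hl']⟩
  -- From index `b` upwards the components are zero, since their source `X.X (n + 1)` is; `step` is
  -- used only below `b`.
  let h (n : ℤ) : H n := Int.inductionOn' (motive := H) n b
    ⟨0, by simp [(hzero (b + 1) (by omega)).eq_of_src (f.f (b + 1)) 0]⟩
    (fun k hk _ ↦ ⟨0, by simp [(hzero (k + 1 + 1) (by omega)).eq_of_src (f.f (k + 1 + 1)) 0]⟩)
    (fun k _ hk ↦ (step k (k - 1) (by omega) hk).choose)
  have hh (k m : ℤ) (hm : k = m + 1) (hk : k ≤ b) :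
      f.f k = X.d k (k + 1) ≫ (h k).1 + (X.XIsoOfEq hm).hom ≫ (h m).1 ≫ W.d m k := by
    obtain rfl : m = k - 1 := by omega
    have : h (k - 1) = (step k (k - 1) (by omega) (h k)).choose := Int.inductionOn'_sub_one hk
    rw [this]
    exact (step k (k - 1) (by omega) (h k)).choose_spec
  refine OneSidedExact.quotient_map_eq_zero f (fun n ↦ (h n).1) (fun n ↦ ?_)
  by_cases hn : n + 1 ≤ b
  · simpa using hh (n + 1) n rfl hn
  · exact (hzero _ (by omega)).eq_of_src _ _

lemma kabProj.leftOrthogonal {X : K E} (hX : kabProj E X) : (acyclicK E).leftOrthogonal X := by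
  intro Y f hY
  obtain ⟨X, rfl⟩ := X.quotient_obj_surjective
  obtain ⟨Y, rfl⟩ := Y.quotient_obj_surjective
  obtain ⟨f, rfl⟩ := (HomotopyCategory.quotient _ _).map_surjective f
  exact IsAcyclic.quotient_map_eq_zero_of_projective hY hX.1 hX.2.1 f

variable (E) in
/-- The restriction of the localization functor `K(E) ⥤ D(E)` to `K^{-,b}(Proj E)`. -/
abbrev kabProjToD : KabProj E ⥤ D E := (kabProj E).ι ⋙ Qh E

/-- Morphisms out of an object left orthogonal to the acyclic complexes do not change under the
Verdier quotient, whatever the target. -/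
lemma kabProjToD_map_bijective (X Y : KabProj E) :
    Function.Bijective ((kabProjToD E).map : (X ⟶ Y) → _) :=
  (ObjectProperty.leftOrthogonal.map_bijective_of_isTriangulated X.2.leftOrthogonal
    (Qh E) Y.1).comp (kabProj E).fullyFaithfulι.homEquiv.bijective

instance : (kabProjToD E).Full := ⟨(kabProjToD_map_bijective _ _).2⟩

instance : (kabProjToD E).Faithful := ⟨fun h ↦ (kabProjToD_map_bijective _ _).1 h⟩

end KProjective

/-! ### Brutal truncation of complexes -/

section BrutalTruncation

variable {E : Type u} [Category.{v} E] [Preadditive E] [HasZeroObject E]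

/-- The brutal truncation of a complex: `f` is the inclusion of the part in degrees `≥ 0` and
`g` is the projection to the part in degrees `< 0`. -/
lemma exists_brutal_truncation (X : CochainComplex E ℤ) :
    ∃ (A B : CochainComplex E ℤ) (f : A ⟶ X) (g : X ⟶ B), f ≫ g = 0 ∧
      (∀ n, 0 ≤ n → IsIso (f.f n) ∧ IsZero (B.X n)) ∧
      (∀ n, n < 0 → IsIso (g.f n) ∧ IsZero (A.X n)) := by
  let AX : ℤ → E
    | Int.ofNat k => X.X (Int.ofNat k)
    | Int.negSucc _ => 0
  let Ad : ∀ n : ℤ, AX n ⟶ AX (n + 1)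
    | Int.ofNat k => X.d (Int.ofNat k) (Int.ofNat (k + 1))
    | Int.negSucc _ => 0
  have Asq : ∀ n : ℤ, Ad n ≫ Ad (n + 1) = 0
    | Int.ofNat k => X.d_comp_d _ _ _
    | Int.negSucc _ => zero_comp
  have hAd (n : ℤ) : (CochainComplex.of AX Ad Asq).d n (n + 1) = Ad n := CochainComplex.of_d ..
  let BX : ℤ → E
    | Int.ofNat k => 0
    | Int.negSucc k => X.X (Int.negSucc k)
  let Bd : ∀ n : ℤ, BX n ⟶ BX (n + 1)
    | Int.ofNat _ => 0
    | Int.negSucc 0 => 0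
    | Int.negSucc (k + 1) => X.d (Int.negSucc (k + 1)) (Int.negSucc k)
  have Bsq : ∀ n : ℤ, Bd n ≫ Bd (n + 1) = 0
    | Int.ofNat _ => zero_comp
    | Int.negSucc 0 => zero_comp
    | Int.negSucc 1 => comp_zero
    | Int.negSucc (k + 2) => X.d_comp_d _ _ _
  have hBd (n : ℤ) : (CochainComplex.of BX Bd Bsq).d n (n + 1) = Bd n := CochainComplex.of_d ..
  let f : ∀ n : ℤ, AX n ⟶ X.X n
    | Int.ofNat k => 𝟙 _
    | Int.negSucc _ => 0
  have hf : ∀ n : ℤ, f n ≫ X.d n (n + 1) = Ad n ≫ f (n + 1)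
    | Int.ofNat k => (Category.id_comp _).trans (Category.comp_id _).symm
    | Int.negSucc _ => zero_comp.trans zero_comp.symm
  let g : ∀ n : ℤ, X.X n ⟶ BX n
    | Int.ofNat k => 0
    | Int.negSucc _ => 𝟙 _
  have hg : ∀ n : ℤ, g n ≫ Bd n = X.d n (n + 1) ≫ g (n + 1)
    | Int.ofNat k => zero_comp.trans comp_zero.symm
    | Int.negSucc 0 => comp_zero.trans comp_zero.symm
    | Int.negSucc (k + 1) => (Category.id_comp _).trans (Category.comp_id _).symm
  refine ⟨CochainComplex.of AX Ad Asq, CochainComplex.of BX Bd Bsq,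
    { f := f, comm' := by rintro i _ rfl; rw [hAd]; exact hf i },
    { f := g, comm' := by rintro i _ rfl; rw [hBd]; exact hg i }, ?_, ?_, ?_⟩
  · ext n
    match n with
    | Int.ofNat k => exact comp_zero
    | Int.negSucc k => exact zero_comp
  · intro n hn
    obtain ⟨k, rfl⟩ := Int.eq_ofNat_of_zero_le hn
    exact ⟨inferInstanceAs (IsIso (𝟙 (X.X (Int.ofNat k)))), isZero_zero E⟩
  · intro n hn
    obtain ⟨k, rfl⟩ := Int.eq_negSucc_of_lt_zero hn
    exact ⟨inferInstanceAs (IsIso (𝟙 (X.X (Int.negSucc k)))), isZero_zero E⟩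

end BrutalTruncation

/-! ### Projective resolutions and essential surjectivity -/

section Resolution

variable {E : Type u} [Category.{v} E] [Preadditive E] [HasZeroObject E]
  [HasBinaryBiproducts E] [RightExactCategory E]

open ConflationCategory RightExactCategory

/-- The brutal truncation triangle in the derived category. -/
lemma AxiomR0Star.exists_brutal_truncation_distTriang (h₀ : AxiomR0Star E)
    (X : CochainComplex E ℤ) :
    ∃ (A B : CochainComplex E ℤ) (f : A ⟶ X) (g : X ⟶ B) (δ : (Q E).obj B ⟶ ((Q E).obj A)⟦(1 : ℤ)⟧),
      Triangle.mk ((Q E).map f) ((Q E).map g) δ ∈ distTriang (D E) ∧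
      (∀ n, 0 ≤ n → IsIso (f.f n) ∧ IsZero (B.X n)) ∧
      (∀ n, n < 0 → IsIso (g.f n) ∧ IsZero (A.X n)) := by
  obtain ⟨A, B, f, g, w, h₁, h₂⟩ := exists_brutal_truncation X
  obtain ⟨δ, hδ⟩ := h₀.exists_distTriang (ShortComplex.mk f g w) (fun n ↦ by
    by_cases hn : 0 ≤ n
    · have := (h₁ n hn).1
      have : IsIso ((ShortComplex.mk f g w).map
        (HomologicalComplex.eval E (ComplexShape.up ℤ) n)).f := this
      -- In degrees `≥ 0` the sequence is an isomorphism followed by a map to a zero object; that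
      -- this is a conflation uses (R0*).
      exact conflation_id_zero (h₀ _) (h₁ n hn).2
    · have := (h₂ n (by lia)).1
      have : IsIso ((ShortComplex.mk f g w).map
        (HomologicalComplex.eval E (ComplexShape.up ℤ) n)).g := this
      exact conflation_of_isIso _ (h₂ n (by lia)).2)
  exact ⟨A, B, f, g, δ, hδ, h₁, h₂⟩

/-- If there are enough projectives, each object `M` has an acyclic augmented projective
resolution `⋯ ⟶ P₁ ⟶ P₀ ⟶ M ⟶ 0`. -/
lemma HasEnoughProjectives.exists_acyclic_augmented (hE : HasEnoughProjectives E)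
    (h₀ : AxiomR0Star E) (M : E) :
    ∃ X : CochainComplex E ℤ, IsAcyclic X ∧ X.IsStrictlyLE 0 ∧ Nonempty (X.X 0 ≅ M) ∧
      ∀ n < 0, IsProjectiveObj (X.X n) := by
  have H (M : E) : ∃ (L P : E) (i : L ⟶ P) (p : P ⟶ M) (w : i ≫ p = 0),
      conflation (ShortComplex.mk i p w) ∧ IsProjectiveObj P := by
    obtain ⟨P, p, hP, L, i, w, h⟩ := hE M
    exact ⟨L, P, i, p, w, h, hP⟩
  choose L P i p w hc hP using H
  -- `S k` is the `k`-th syzygy of `M`. The term in degree `-1 - k` is the chosen projective cover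
  -- of `S k` by a deflation, and the cycles there are `S (k + 1)`.
  let S : ℕ → E := fun k ↦ Nat.rec M (fun _ N ↦ L N) k
  let WX : ℤ → E
    | Int.ofNat 0 => M
    | Int.ofNat (k + 1) => 0
    | Int.negSucc k => P (S k)
  let WZ : ℤ → E
    | Int.ofNat 0 => M
    | Int.ofNat (k + 1) => 0
    | Int.negSucc k => S (k + 1)
  let Wi : ∀ n : ℤ, WZ n ⟶ WX n
    | Int.ofNat 0 => 𝟙 M
    | Int.ofNat (k + 1) => 0
    | Int.negSucc k => i (S k)
  let Wp : ∀ n : ℤ, WX n ⟶ WZ (n + 1)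
    | Int.ofNat _ => 0
    | Int.negSucc 0 => p (S 0)
    | Int.negSucc (k + 1) => p (S (k + 1))
  have Ww : ∀ n : ℤ, Wi n ≫ Wp n = 0
    | Int.ofNat _ => comp_zero
    | Int.negSucc 0 => w _
    | Int.negSucc (k + 1) => w _
  have Wconf : ∀ n : ℤ, conflation (ShortComplex.mk (Wi n) (Wp n) (Ww n))
    | Int.ofNat 0 => by
        have : IsIso (ShortComplex.mk (Wi 0) (Wp 0) (Ww 0)).f :=
          inferInstanceAs (IsIso (𝟙 M))
        exact conflation_id_zero (h₀ M) (isZero_zero E)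
    | Int.ofNat (k + 1) => by
        have : IsIso (ShortComplex.mk (Wi (Int.ofNat (k + 1))) (Wp (Int.ofNat (k + 1)))
            (Ww (Int.ofNat (k + 1)))).g :=
          (isZero_zero E).isIso (isZero_zero E) _
        exact conflation_of_isIso _ (isZero_zero E)
    | Int.negSucc 0 => hc _
    | Int.negSucc (k + 1) => hc _
  let W : CochainComplex E ℤ := CochainComplex.of WX (fun n ↦ Wp n ≫ Wi (n + 1))
    (fun n ↦ by rw [Category.assoc, reassoc_of% (Ww (n + 1)), zero_comp, comp_zero])
  refine ⟨W, Splicing.isAcyclic ⟨WZ, Wi, Wp, Ww, Wconf, fun n ↦ (CochainComplex.of_d WX (fun n ↦ Wp n ≫ Wi (n + 1)) _).symm⟩,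
    ?_, ⟨Iso.refl _⟩, ?_⟩
  · rw [CochainComplex.isStrictlyLE_iff]
    intro n hn
    obtain ⟨k, rfl⟩ := Int.eq_ofNat_of_zero_le hn.le
    obtain ⟨l, rfl⟩ : ∃ l, k = l + 1 := ⟨k - 1, by lia⟩
    exact isZero_zero E
  · intro n hn
    obtain ⟨k, rfl⟩ := Int.eq_negSucc_of_lt_zero hn
    exact hP _

lemma isProjectiveObj_of_iso {P P' : E} (e : P ≅ P') (h : IsProjectiveObj P) :
    IsProjectiveObj P' := by
  rw [isProjectiveObj_iff] at h ⊢
  intro B C g hg f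
  obtain ⟨l, hl⟩ := h g hg (e.hom ≫ f)
  exact ⟨e.inv ≫ l, by simp [hl]⟩

/-- The map `0 ⟶ X` has cone `X`, so it is inverted in `D(E)`. -/
lemma isZero_Q_obj {X : CochainComplex E ℤ} (hX : IsAcyclic X) : IsZero ((Q E).obj X) := by
  have := Localization.inverts (Qh E) (acyclicK E).trW _
    (ObjectProperty.trW.mk (acyclicK E)
      (contractible_distinguished₁ ((HomotopyCategory.quotient _ _).obj X)) hX)
  exact ((Qh E).map_isZero (isZero_zero _)).of_iso (@asIso _ _ _ _ _ this).symm

/-- The essential image is stable under shifts, which permits normalising degrees before resolving.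
-/
lemma essImage_of_shift (X : CochainComplex E ℤ) (n : ℤ)
    (h : (kabProjToD E).essImage ((Q E).obj (X⟦n⟧))) :
    (kabProjToD E).essImage ((Q E).obj X) := by
  refine ((kabProjToD E).essImage.prop_shift_iff_of_isStableUnderShift _ n).1
    ((kabProjToD E).essImage.prop_of_iso ?_ h)
  exact (Qh E).mapIso (((HomotopyCategory.quotient _ _).commShiftIso n).app X) ≪≫
    ((Qh E).commShiftIso n).app _

/-- Complexes concentrated in degree `0` have projective resolutions. -/
lemma HasEnoughProjectives.essImage_of_degree_zero (hE : HasEnoughProjectives E)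
    (h₀ : AxiomR0Star E) (X : CochainComplex E ℤ) [X.IsStrictlyGE 0] [X.IsStrictlyLE 0] :
    (kabProjToD E).essImage ((Q E).obj X) := by
  obtain ⟨M, ⟨e⟩⟩ := X.exists_iso_single 0
  obtain ⟨Y, hY, hY₀, ⟨e₀⟩, hP⟩ := hE.exists_acyclic_augmented h₀ M
  obtain ⟨A, B, f, g, δ, hT, h₁, h₂⟩ := h₀.exists_brutal_truncation_distTriang Y
  have hA : A.IsStrictlyGE 0 := by
    rw [CochainComplex.isStrictlyGE_iff]
    exact fun n hn ↦ (h₂ n hn).2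
  have hA' : A.IsStrictlyLE 0 := by
    rw [CochainComplex.isStrictlyLE_iff]
    intro n hn
    have := (h₁ n hn.le).1
    exact (Y.isZero_of_isStrictlyLE 0 n).of_iso (asIso (f.f n))
  have hB : B.IsStrictlyLE 0 := by
    rw [CochainComplex.isStrictlyLE_iff]
    exact fun n hn ↦ (h₁ n hn.le).2
  obtain ⟨N, ⟨e'⟩⟩ := A.exists_iso_single 0
  have hf₀ := (h₁ 0 le_rfl).1
  let eMN : M ≅ N := e₀.symm ≪≫ (asIso (f.f 0)).symm ≪≫
    (HomologicalComplex.eval E (ComplexShape.up ℤ) 0).mapIso e' ≪≫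
    HomologicalComplex.singleObjXSelf (ComplexShape.up ℤ) 0 N
  let eXA : X ≅ A := e ≪≫ (HomologicalComplex.single E (ComplexShape.up ℤ) 0).mapIso eMN ≪≫ e'.symm
  -- Truncating the augmented resolution `Y` leaves `A`, which is `M` in degree `0`, and `B`, its
  -- projective part in negative degrees. As `Y` vanishes in `D(E)`, the connecting morphism
  -- identifies `B` with `A⟦1⟧`, so `B` resolves `X⟦1⟧`.
  have hδ : IsIso δ := by
    have := (Triangle.isZero₂_iff_isIso₃ _ hT).1 (isZero_Q_obj hY)
    exact this
  let eBX : (Q E).obj B ≅ (Q E).obj (X⟦(1 : ℤ)⟧) :=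
    asIso δ ≪≫ (shiftFunctor (D E) (1 : ℤ)).mapIso ((Q E).mapIso eXA.symm) ≪≫
    (((Qh E).commShiftIso (1 : ℤ)).app _).symm ≪≫
    (Qh E).mapIso (((HomotopyCategory.quotient _ _).commShiftIso (1 : ℤ)).app X).symm
  have hB' : kabProj E ((HomotopyCategory.quotient _ _).obj B) := by
    refine ⟨⟨0, hB⟩, fun n ↦ ?_, X⟦(1 : ℤ)⟧, IsBounded.shift ⟨⟨0, inferInstance⟩, ⟨0, inferInstance⟩⟩ 1, ⟨eBX⟩⟩
    by_cases hn : 0 ≤ n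
    · exact isProjectiveObj_of_isZero (h₁ n hn).2
    · have := (h₂ n (by lia)).1
      let e : Y.X n ≅ B.X n := asIso (g.f n)
      exact isProjectiveObj_of_iso e (hP n (by lia))
  exact essImage_of_shift X 1 ⟨⟨_, hB'⟩, ⟨eBX⟩⟩

/-- Induction on the length: brutal truncation splits off the degree `0` term, the remaining part
shifted by `-1` is one degree shorter, and the essential image is closed under extensions in
triangles. -/
lemma HasEnoughProjectives.essImage_of_isStrictlyGE_neg (hE : HasEnoughProjectives E)
    (h₀ : AxiomR0Star E) (m : ℕ) (X : CochainComplex E ℤ) [X.IsStrictlyGE (-m)]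
    [X.IsStrictlyLE 0] : (kabProjToD E).essImage ((Q E).obj X) := by
  induction m generalizing X with
  | zero =>
    have : X.IsStrictlyGE 0 := by simpa using (inferInstanceAs (X.IsStrictlyGE (-(0 : ℕ))))
    exact hE.essImage_of_degree_zero h₀ X
  | succ m hm =>
    obtain ⟨A, B, f, g, δ, hT, h₁, h₂⟩ := h₀.exists_brutal_truncation_distTriang X
    have hA : A.IsStrictlyGE 0 := by
      rw [CochainComplex.isStrictlyGE_iff]
      exact fun n hn ↦ (h₂ n hn).2
    have hA' : A.IsStrictlyLE 0 := by
      rw [CochainComplex.isStrictlyLE_iff]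
      intro n hn
      have := (h₁ n hn.le).1
      exact (X.isZero_of_isStrictlyLE 0 n).of_iso (asIso (f.f n))
    have hB : B.IsStrictlyLE (-1) := by
      rw [CochainComplex.isStrictlyLE_iff]
      exact fun n hn ↦ (h₁ n (by lia)).2
    have hB' : B.IsStrictlyGE (-(m + 1 : ℕ)) := by
      rw [CochainComplex.isStrictlyGE_iff]
      intro n hn
      have := (h₂ n (by lia)).1
      exact (X.isZero_of_isStrictlyGE (-(m + 1 : ℕ)) n hn).of_iso (asIso (g.f n)).symm
    have : CochainComplex.IsStrictlyLE (B⟦(-1 : ℤ)⟧) 0 := B.isStrictlyLE_shift (-1) (-1) 0 (by lia)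
    have : CochainComplex.IsStrictlyGE (B⟦(-1 : ℤ)⟧) (-m) :=
      B.isStrictlyGE_shift (-(m + 1 : ℕ)) (-1) (-m) (by lia)
    exact (kabProjToD E).essImage.ext_of_isTriangulatedClosed₂ _ hT
      (hE.essImage_of_degree_zero h₀ A) (essImage_of_shift B (-1) (hm _))

lemma HasEnoughProjectives.boundedD_le_essImage (hE : HasEnoughProjectives E)
    (h₀ : AxiomR0Star E) : boundedD E ≤ (kabProjToD E).essImage := by
  rintro M ⟨X, ⟨⟨a, _⟩, ⟨b, _⟩⟩, ⟨e⟩⟩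
  refine (kabProjToD E).essImage.prop_of_iso e.symm (essImage_of_shift X b ?_)
  have : CochainComplex.IsStrictlyLE (X⟦b⟧) 0 := X.isStrictlyLE_shift b b 0 (by lia)
  have : CochainComplex.IsStrictlyGE (X⟦b⟧) (a - b) := X.isStrictlyGE_shift a b (a - b) (by lia)
  -- The truncated difference `toNat` also covers `b < a`, where `-(b - a).toNat = 0 ≤ a - b`.
  have : CochainComplex.IsStrictlyGE (X⟦b⟧) (-((b - a).toNat : ℤ)) :=
    CochainComplex.isStrictlyGE_of_ge _ _ (a - b) (by lia)
  exact hE.essImage_of_isStrictlyGE_neg h₀ (b - a).toNat _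

lemma kabProjToDb_isTriangulated : (kabProjToDb E).IsTriangulated :=
  ObjectProperty.isTriangulated_lift _ (kabProjToD E) _

lemma HasEnoughProjectives.kabProjToDb_isEquivalence (hE : HasEnoughProjectives E)
    (h₀ : AxiomR0Star E) : (kabProjToDb E).IsEquivalence where
  faithful := inferInstanceAs ((boundedD E).lift (kabProjToD E) _).Faithful
  full := inferInstanceAs ((boundedD E).lift (kabProjToD E) _).Full
  essSurj := ⟨fun M ↦ by
    obtain ⟨P, ⟨e⟩⟩ := hE.boundedD_le_essImage h₀ _ M.2
    exact ⟨P, ⟨(boundedD E).fullyFaithfulι.preimageIso e⟩⟩⟩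

end Resolution

end

end OneSidedExact

theorem mainTheorem4 {E : Type u} [Category.{v} E] [Preadditive E] [HasZeroObject E]
    [HasBinaryBiproducts E] [RightExactCategory E] :
    -- the stalk embedding is fully faithful
    ((stalk E).Full ∧ (stalk E).Faithful) ∧
    -- there are no negative self-extensions
    (∀ (X Y : E) (n : ℤ), 0 < n → ∀ f : ((stalk E).obj X)⟦n⟧ ⟶ (stalk E).obj Y, f = 0) ∧
    (AxiomR0Star E →
      -- conflations in `E` give triangles in `D(E)`
      (∀ S : ShortComplex E, ConflationCategory.conflation S →
        ∃ δ : (stalk E).obj S.X₃ ⟶ ((stalk E).obj S.X₁)⟦(1 : ℤ)⟧,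
          Triangle.mk ((stalk E).map S.f) ((stalk E).map S.g) δ ∈ distTriang (D E)) ∧
      -- degreewise conflations of complexes give triangles in `D(E)`
      (∀ S : ShortComplex (CochainComplex E ℤ),
        (∀ n : ℤ, ConflationCategory.conflation
          (S.map (HomologicalComplex.eval E (ComplexShape.up ℤ) n))) →
        ∃ δ : (Q E).obj S.X₃ ⟶ ((Q E).obj S.X₁)⟦(1 : ℤ)⟧,
          Triangle.mk ((Q E).map S.f) ((Q E).map S.g) δ ∈ distTriang (D E)) ∧
      -- if there are enough projectives, then the functor `K^{-,b}(Proj E) ⥤ Dᵇ(E)` is an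
      -- equivalence of triangulated categories
      (HasEnoughProjectives E →
        (kabProjToDb E).IsTriangulated ∧ (kabProjToDb E).IsEquivalence)) := by
  exact ⟨stalk_full_faithful E, shift_stalk_hom_eq_zero, fun h₀ ↦
    ⟨h₀.exists_distTriang_stalk, h₀.exists_distTriang, fun hE ↦
      ⟨kabProjToDb_isTriangulated, hE.kabProjToDb_isEquivalence h₀⟩⟩⟩
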